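/- Let $\varphi$ be the prime CNF of a nonconstant monotone Boolean function $f$ of the variables $x_1,\dots,x_n$ ($n\ge 1$), all of which occur in $\varphi$. Let $\|\varphi\|$ be the number of literal occurrences in $\varphi$, let $\psi=\bigvee_{t\in PI(f)}t$ be the prime DNF of $f$ (equivalently, after exchanging $\vee$ and $\wedge$, the prime CNF of the dual function $f^d$), and let $|\psi|$ and $\|\psi\|$ be its number of terms and of literal occurrences. For a term $t$ let $t_i$ be its part on the variables $x_1,\dots,x_i$, and let $f_i$ be $f$ with $x_j=1$ for all $j>i$. Let $\Delta^i$ be the set of clauses of $\varphi$ whose variable of largest index is $x_i$, and let $\Delta^i[t]$ be the CNF of all clauses $c$ that contain no variable of $t_{i-1}$ and for which $c\vee x_i\in\Delta^i$. Algorithm R-Dualize on $\varphi$: compute the smallest prime implicant of $f$ (terms are compared lexicographically as characteristic vectors) and put it into a queue $Q$. While $Q\neq\emptyset$: remove the smallest term $t$ from $Q$ and output it; for every $i$ such that $x_i$ is in $t$ and $\Delta^i[t]\not\equiv 1$, compute the prime DNF $\rho$ of $\Delta^i[t]$ by a recursive call (if $\Delta^i[t]\equiv 0$, then $\rho$ has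 no term and no call is made), and for every term $t'$ of $\rho$ such that $t_{i-1}\wedge t'$ is a prime implicant of $f_i$, add to $Q$ the smallest prime implicant $t^*$ of $f$ with $t^*_i=t_{i-1}\wedge t'$. The recursion depth of a run is the largest number of nested activations of the algorithm; it is $1$ if there is no recursive call. Time is counted on a unit-cost random access machine, with $Q$ stored as a binary tree of height $n$. Then R-Dualize halts on every such $\varphi$ and its output is $\psi$, each prime implicant of $f$ exactly once; and there is an absolute constant $C$ such that the following hold for all such $\varphi$. 1. If the recursion depth of the run on $\varphi$ is $d$, then $d\ge 1$ and the running time is at most $C\, n^{d-1}|\psi|^{d-1}\|\varphi\|$. 2. If every clause of $\varphi$ has at most $k$ literals, then the recursion depth is at most $k$ and the running time is at most $C\, n^{k-1}|\psi|^{k-1}\|\varphi\|$. Consequently, for every fixed $k$ there is a polynomial $p_k$ such that R-Dualize dualizes every such $\varphi$ whose clauses have at most $k$ literals in at most $p_k(\|\varphi\|+\|\psi\|)$ steps, i.e. in polynomial total time. -/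

import Mathlib

namespace RDualization

/-! ### Boolean functions, clauses, terms, primality -/

/-- A Boolean function of `n` variables. -/
abbrev BoolFn (n : ℕ) := (Fin n → Bool) → Bool

/-- The literals over `n` variables: `(i, true)` is the variable, `(i, false)` its complement. -/
abbrev Lit (n : ℕ) := Fin n × Bool

/-- A set of literals is a legal clause (or term) if it contains at most one of a variable and
its complement. -/
def Consistent {n : ℕ} (L : Finset (Lit n)) : Prop :=
  ∀ i : Fin n, ¬ ((i, true) ∈ L ∧ (i, false) ∈ L)

/-- The function represented by the disjunction of a set of literals. -/
def clauseFn {n : ℕ} (L : Finset (Lit n)) : BoolFn n :=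
  fun v => decide (∃ p ∈ L, v p.1 = p.2)

/-- The function represented by the conjunction of a set of literals. -/
def termFn {n : ℕ} (L : Finset (Lit n)) : BoolFn n :=
  fun v => decide (∀ p ∈ L, v p.1 = p.2)

/-- `t` is a prime implicant of `f`: a term `t ≤ f` such that no implicant `t'` of `f` has
`t < t'` (functions are compared pointwise). -/
def IsPrimeImplicant {n : ℕ} (f : BoolFn n) (t : Finset (Lit n)) : Prop :=
  Consistent t ∧ termFn t ≤ f ∧
    ∀ t' : Finset (Lit n), Consistent t' → termFn t' ≤ f → ¬ termFn t < termFn t'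

/-- `c` is a prime implicate of `f`: a clause `c ≥ f` such that no implicate `c'` of `f` has
`c' < c`. -/
def IsPrimeImplicate {n : ℕ} (f : BoolFn n) (c : Finset (Lit n)) : Prop :=
  Consistent c ∧ f ≤ clauseFn c ∧
    ∀ c' : Finset (Lit n), Consistent c' → f ≤ clauseFn c' → ¬ clauseFn c' < clauseFn c

/-- The dual function: complement the arguments and the value. -/
def dual {n : ℕ} (f : BoolFn n) : BoolFn n := fun v => !(f fun i => !(v i))

open Classical in
/-- The set of all prime implicants of `f`. For monotone `f` these are exactly the terms of its
prime DNF. -/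
noncomputable def primeImplicants {n : ℕ} (f : BoolFn n) : Finset (Finset (Lit n)) :=
  Finset.univ.filter fun t => IsPrimeImplicant f t

/-! ### Encoding of monotone formulas: a clause (or term) is a list of variable indices, a formula
is a list of clauses (or terms) -/

/-- The set of positive literals listed by `l`. -/
def posLits (n : ℕ) (l : List ℕ) : Finset (Lit n) :=
  Finset.univ.filter fun p => p.2 = true ∧ (p.1 : ℕ) ∈ l

/-- The function of `n` variables represented by a monotone CNF. -/
def cnfFn (n : ℕ) (φ : List (List ℕ)) : BoolFn n :=
  fun v => decide (∀ c ∈ φ, clauseFn (posLits n c) v = true)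

/-- The length of a formula: its number of literals. -/
def size (φ : List (List ℕ)) : ℕ := (φ.map List.length).sum

/-- `φ` lists the members of a set of sets of positive literals over the variables
`0, …, n - 1`, each set once and each literal of it once. -/
structure WellFormed (n : ℕ) (φ : List (List ℕ)) : Prop where
  lt : ∀ c ∈ φ, ∀ x ∈ c, x < n
  nodup_lits : ∀ c ∈ φ, c.Nodup
  nodup : (φ.map (posLits n)).Nodup

/-- `φ` is a prime monotone CNF in which exactly the variables `0, …, n - 1` occur. -/
structure IsPrimeCNF (n : ℕ) (φ : List (List ℕ)) : Prop where
  wf : WellFormed n φ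
  occurs : ∀ x < n, ∃ c ∈ φ, x ∈ c
  prime : ∀ c ∈ φ, IsPrimeImplicate (cnfFn n φ) (posLits n c)

/-- Every clause has at most `k` literals. -/
def IsKCNF (k : ℕ) (φ : List (List ℕ)) : Prop := ∀ c ∈ φ, c.length ≤ k

/-- `ψ` is a correct answer to the dualization problem for the monotone function `f` represented
by `φ`: read as a DNF it is the prime DNF of `f` (it lists all prime implicants of `f`), and read
as a CNF it is the prime CNF of the dual of `f` (it lists all prime implicates of the dual). -/
structure SolvesDualization (n : ℕ) (φ ψ : List (List ℕ)) : Prop where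
  wf : WellFormed n ψ
  primeDNF : ∀ t, t ∈ ψ.map (posLits n) ↔ t ∈ primeImplicants (cnfFn n φ)
  dualCNF : ∀ c, c ∈ ψ.map (posLits n) ↔ IsPrimeImplicate (dual (cnfFn n φ)) c

/-- The number of terms of the prime DNF of the function represented by `φ`. -/
noncomputable def psiCard (n : ℕ) (φ : List (List ℕ)) : ℕ := (primeImplicants (cnfFn n φ)).card

/-- The length (number of literals) of the prime DNF of the function represented by `φ`. -/
noncomputable def psiSize (n : ℕ) (φ : List (List ℕ)) : ℕ :=
  ∑ t ∈ primeImplicants (cnfFn n φ), t.card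

/-! ### Step-counting computations

A unit-cost random access machine. A computation carries the number of steps made so far and the
largest recursion level entered so far; `none` is divergence. Every list cell that is visited,
every array access and every tree node that is visited is charged at least one step, and between
two charges only a bounded number of operations on indices and pointers is carried out. -/

/-- Steps made and largest recursion level entered. -/
structure Meter where
  steps : ℕ
  depth : ℕ

/-- Metered computations. -/
abbrev Comp := StateT Meter Option

/-- Charge `k` steps. -/
def charge (k : ℕ) : Comp Unit := modify fun s => ⟨s.steps + k, s.depth⟩

/-- Record that recursion level `l` is entered. -/
def enter (l : ℕ) : Comp Unit := modify fun s => ⟨s.steps, max s.depth l⟩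

/-- Allocate an array with `m` cells, all holding `a`: `m + 1` steps. An array is modelled by the
function that gives its contents; each array below is only used in its latest version. -/
def newArray {α : Type} (m : ℕ) (a : α) : Comp (ℕ → α) := do
  charge (m + 1)
  pure fun _ => a

/-- Read a cell. -/
def readCell {α : Type} (A : ℕ → α) (i : ℕ) : Comp α := do
  charge 1
  pure (A i)

/-- Overwrite a cell. -/
def writeCell {α : Type} (A : ℕ → α) (i : ℕ) (a : α) : Comp (ℕ → α) := do
  charge 1
  pure (Function.update A i a)

/-! ### The priority queue: a binary tree

A set of terms over the variables `j, j + 1, …, m - 1` is a tree of height `m - j`; the left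
son of the root holds the terms that contain variable `j`, the right son the other ones. -/

/-- Binary trees, as used for the queue. -/
inductive Tree where
  | nil : Tree
  | leaf : Tree
  | node (left right : Tree) : Tree

/-- A node, or the empty tree if both sons are empty. -/
def Tree.join : Tree → Tree → Tree
  | .nil, .nil => .nil
  | l, r => .node l r

/-- The sons of the root. -/
def Tree.sons : Tree → Tree × Tree
  | .node l r => (l, r)
  | _ => (.nil, .nil)

/-- Insert the term whose characteristic vector is `A`; `j` is the current variable and the first
argument the remaining height. -/
def Tree.insert (A : ℕ → Bool) : (height : ℕ) → (j : ℕ) → Tree → Comp Tree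
  | 0, _, _ => do
    charge 1
    pure .leaf
  | h + 1, j, T => do
    charge 1
    if ← readCell A j then
      pure (.node (← Tree.insert A h (j + 1) T.sons.1) T.sons.2)
    else
      pure (.node T.sons.1 (← Tree.insert A h (j + 1) T.sons.2))

/-- Remove the smallest term, i.e. the one with the lexicographically smallest characteristic
vector, and return it as the list of its variables; `none` if the tree is empty. -/
def Tree.popMin : (j : ℕ) → Tree → Comp (Option (List ℕ × Tree))
  | _, .nil => do
    charge 1
    pure none
  | _, .leaf => do
    charge 1
    pure (some ([], .nil))
  | j, .node l r => do
    charge 1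
    match ← Tree.popMin (j + 1) r with
    | some (t, r') => pure (some (t, Tree.join l r'))
    | none =>
      match ← Tree.popMin (j + 1) l with
      | some (t, l') => pure (some (j :: t, Tree.join l' .nil))
      | none => pure none

/-! ### Substeps of the algorithm

`φ` is a CNF over the variables `0, …, m - 1`. Its restriction `φ_i` (all variables after the
`i`-th fixed to 1) consists of the clauses without a variable after the `i`-th, so that the
clauses in `Δ^i` are the ones with largest variable `i`. The array `B` holds `Δ^i` in cell `i`. -/

/-- The largest variable of a clause. -/
def maxVar (c : List ℕ) : Comp ℕ :=
  c.foldlM (fun b x => do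
    charge 1
    pure (max b x)) 0

/-- The array of all `Δ^i`. -/
def buckets (m : ℕ) (φ : List (List ℕ)) : Comp (ℕ → List (List ℕ)) := do
  let B ← newArray m []
  φ.foldlM (fun B c => do
    charge 1
    let i ← maxVar c
    let D ← readCell B i
    writeCell B i (c :: D)) B

/-- Set the cells listed in `t`. -/
def markAll (A : ℕ → Bool) (t : List ℕ) : Comp (ℕ → Bool) :=
  t.foldlM (fun A x => do
    charge 1
    writeCell A x true) A

/-- The variables in `t` before the `i`-th. -/
def before (i : ℕ) : List ℕ → Comp (List ℕ)
  | [] => pure []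
  | x :: t => do
    charge 1
    let r ← before i t
    pure (if x < i then x :: r else r)

/-- The clause without variable `i`. -/
def strip (i : ℕ) : List ℕ → Comp (List ℕ)
  | [] => pure []
  | x :: c => do
    charge 1
    let r ← strip i c
    pure (if x = i then r else x :: r)

/-- Does the clause contain a variable that is set in `A`? -/
def meets (A : ℕ → Bool) (c : List ℕ) : Comp Bool :=
  c.foldlM (fun b x => do
    charge 1
    let a ← readCell A x
    pure (b || a)) false

/-- `Δ^i[t]` from `D = Δ^i` and the characteristic vector `A` of a term `t`: the clauses `c`
without a variable of `t` such that `c ∨ x_i` is in `Δ^i`. -/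
def reduct (i : ℕ) (D : List (List ℕ)) (A : ℕ → Bool) : Comp (List (List ℕ)) :=
  D.foldlM (fun Δ c => do
    charge 1
    let r ← strip i c
    let b ← meets A r
    pure (if b then Δ else r :: Δ)) []

/-- Is the empty clause in the CNF? -/
def hasEmptyClause (Δ : List (List ℕ)) : Comp Bool :=
  Δ.foldlM (fun b c => do
    charge 1
    pure (b || c.isEmpty)) false

/-- Given the characteristic vector `A` of a term over the variables before `j`, complete it to
the smallest implicant that agrees with it on these variables: run through `j`, …, `j + h - 1` and
set a variable only if some clause would be falsified otherwise. -/
def complete (B : ℕ → List (List ℕ)) (A : ℕ → Bool) (j h : ℕ) : Comp (ℕ → Bool) :=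
  (List.range' j h).foldlM (fun A i => do
    charge 1
    let D ← readCell B i
    let needed ← D.foldlM (fun b c => do
      charge 1
      let a ← meets A c
      pure (b || !a)) false
    if needed then writeCell A i true else pure A) A

/-- The number of variables of the clause that are set in `A`, and the last of them. -/
def countHits (A : ℕ → Bool) (c : List ℕ) : Comp (ℕ × ℕ) :=
  c.foldlM (fun p x => do
    charge 1
    let a ← readCell A x
    pure (if a then (p.1 + 1, x) else p)) (0, 0)

/-- Is the term `u` with characteristic vector `A` a prime implicant of `f_i`? Every clause of
`φ_i` must contain a variable of `u`, and every variable of `u` must be the only one of `u` in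
some clause of `φ_i`. -/
def isPrimePrefix (m : ℕ) (B : ℕ → List (List ℕ)) (i : ℕ) (u : List ℕ) (A : ℕ → Bool) :
    Comp Bool := do
  let crit ← newArray m false
  let p ← (List.range (i + 1)).foldlM (fun (p : Bool × (ℕ → Bool)) j => do
    charge 1
    let D ← readCell B j
    D.foldlM (fun (p : Bool × (ℕ → Bool)) c => do
      charge 1
      let q ← countHits A c
      if q.1 = 0 then
        pure (false, p.2)
      else if q.1 = 1 then
        pure (p.1, ← writeCell p.2 q.2 true)
      else
        pure p) p) (true, crit)
  u.foldlM (fun b x => do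
    charge 1
    let a ← readCell p.2 x
    pure (b && a)) p.1

/-- The innermost step: if `t_{i-1} ∧ t'` is a prime implicant of `f_i`, insert into the queue the
smallest prime implicant of `f` that agrees with it on the variables up to the `i`-th. -/
def tryInsert (m : ℕ) (B : ℕ → List (List ℕ)) (t : List ℕ) (i : ℕ) (t' : List ℕ) (Q : Tree) :
    Comp Tree := do
  charge 1
  let s ← before i t
  let A ← newArray m false
  let A ← markAll A s
  let A ← markAll A t'
  charge s.length
  if ← isPrimePrefix m B i (s ++ t') A then
    let A ← complete B A (i + 1) (m - (i + 1))
    Tree.insert A m 0 Q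
  else
    pure Q

/-! ### The algorithm

The number `fuel` only makes the definitions structurally recursive: it is no part of the
algorithm, it has no influence on the result as long as it does not run out, and a computation
that runs out of it counts as divergent. -/

/-- The main loop of Dualize on a CNF over the variables `0, …, m - 1`. The procedure `sub` is
called as `sub i Δ` to compute the prime DNF of a CNF `Δ` over the variables before the `i`-th;
`out` holds the terms that were output so far, the last one first. There is no call if `Δ^i[t]` is
constant: for the constant 1 (no clause) the index is skipped, and the prime DNF of the constant 0
(there is an empty clause) has no term. -/
def mainLoop (sub : ℕ → List (List ℕ) → Comp (List (List ℕ))) (m : ℕ) (B : ℕ → List (List ℕ)) :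
    (fuel : ℕ) → Tree → (out : List (List ℕ)) → Comp (List (List ℕ))
  | 0, _, _ => failure
  | fuel + 1, Q, out => do
    charge 1
    match ← Tree.popMin 0 Q with
    | none => pure out
    | some (t, Q) =>
      let A ← newArray m false
      let A ← markAll A t
      let Q ← t.foldlM (fun Q i => do
        charge 1
        let D ← readCell B i
        let Δ ← reduct i D A
        if Δ.isEmpty then
          pure Q
        else if ← hasEmptyClause Δ then
          pure Q
        else
          let ρ ← sub i Δ
          ρ.foldlM (fun Q t' => tryInsert m B t i t' Q) Q) Q
      mainLoop sub m B fuel Q (t :: out)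

/-- Recursive Dualize at recursion level `l`, on a nonconstant prime monotone CNF `φ` over the
variables `0, …, m - 1`: Dualize, with recursive calls at level `l + 1` as the procedure that
computes the prime DNFs of the CNFs `Δ^i[t]`. -/
def rDualize : (fuel : ℕ) → (l m : ℕ) → (φ : List (List ℕ)) → Comp (List (List ℕ))
  | 0, _, _, _ => failure
  | fuel + 1, l, m, φ => do
    enter l
    charge 1
    let B ← buckets m φ
    let A ← newArray m false
    let A ← complete B A 0 m
    let Q ← Tree.insert A m 0 Tree.nil
    mainLoop (rDualize fuel (l + 1)) m B fuel Q []

/-- Recursive Dualize, started on the CNF `φ` over the variables `0, …, n - 1`, halts with output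
`ψ`, and `r` holds the number of steps and the recursion depth of the run (the depth of a run
without recursive calls is 1). -/
def HaltsWith (n : ℕ) (φ ψ : List (List ℕ)) (r : Meter) : Prop :=
  ∃ fuel₀ : ℕ, ∀ fuel ≥ fuel₀, (rDualize fuel 1 n φ).run ⟨0, 0⟩ = some (ψ, r)

end RDualization

/-! A term on positive literals is an implicant of a monotone CNF exactly when it meets every
clause, so the prime implicants are the minimal hitting sets: sets that meet every clause and in
which every element has a private clause, one met by no other element
(`isPrimeImplicant_cnfFn_iff`). Everything is proved for minimal hitting sets of arbitrary CNFs
without empty clause (`Valid`), since the reducts passed to recursive calls need be neither prime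
nor contain all variables.

Correctness is a search argument. A term `u` inserted while `t` is treated exceeds `t`
lexicographically, because below `i` it properly contains the part of `t` there (`lexLt_greedy`).
Hence no term returns to the queue after its output. Conversely, every minimal hitting set `u` other
than the greedy one is inserted for a smaller one (`exists_predecessor`): take the last `i` at which
the prefix of `u` is not a minimal hitting set of the clauses below `i`, shrink that prefix to a
minimal one, and complete it greedily to `t`; what was removed is a minimal hitting set of the
reduct for `t` and `i`. Induction along the lexicographic order shows that all of them are output.

For the time, a reduct has at most as many minimal hitting sets as the CNF itself
(`card_minHits_reduct_le`), and the clauses with largest variable `i`, taken over all `i`, partition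
the formula. Let a call with `m` variables, length `s` and `N` solutions have depth `e + 1`. There
are `N` rounds, and each index `i` of a round costs one call on at most `i` variables and `s i`
literals, where the `s i` add up to `s`. The sum of `i + s i` is at most half of `m (m + s)` if `m ≥
2`, so passing from depth `e` to `e + 1` gains the factor `m N / 2`; the spare half absorbs all
other work and the constant stays 100 at every level (`cost_recursion`). A run without calls has
just one output, so the number of terms returned by a call is bounded by its `e`-th power even for
`e = 0`; this pays for the insertions.

Stripping `x_i` shortens each clause, so clause length `k` bounds the depth by `k`. Finally `n` is
at most the length of the formula, as all variables occur, which turns `n + s` into `2 s` and 100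
into 200. -/

namespace RDualization

/-! ### Metered computations -/

/-- From every meter the computation returns `a`, makes at most `K` steps and reaches exactly
recursion level `d`. -/
def Within {α : Type} (c : Comp α) (a : α) (K d : ℕ) : Prop :=
  ∃ k ≤ K, ∀ s : Meter, c.run s = some (a, ⟨s.steps + k, max s.depth d⟩)

section Within
variable {α β γ : Type}

theorem Within.mono {c : Comp α} {a : α} {K K' d : ℕ} (h : Within c a K d) (hK : K ≤ K') :
    Within c a K' d := by
  obtain ⟨k, hk, h⟩ := h
  exact ⟨k, hk.trans hK, h⟩

theorem within_pure (a : α) : Within (pure a) a 0 0 :=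
  ⟨0, le_rfl, fun s => by simp⟩

theorem within_charge (k : ℕ) : Within (charge k) () k 0 :=
  ⟨k, le_rfl, fun s => by simp [charge]⟩

theorem within_enter (l : ℕ) : Within (enter l) () 0 l :=
  ⟨0, le_rfl, fun s => by simp [enter]⟩

/-- Step counts add and levels combine by maximum. Level `0` is neutral for the maximum and so
stands for a computation that enters no level. -/
theorem Within.bind' {c : Comp α} {f : α → Comp β} {a : α} {b : β} {K K' d d' : ℕ}
    (h : Within c a K d) (h' : Within (f a) b K' d') :
    Within (c >>= f) b (K + K') (max d d') := by
  obtain ⟨k, hk, h⟩ := h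
  obtain ⟨k', hk', h'⟩ := h'
  refine ⟨k + k', by omega, fun s => ?_⟩
  rw [StateT.run_bind, h s]
  simp [h', add_assoc, max_assoc]

theorem Within.bind {c : Comp α} {f : α → Comp β} {a : α} {b : β} {K K' d : ℕ}
    (h : Within c a K 0) (h' : Within (f a) b K' d) :
    Within (c >>= f) b (K + K') d := by
  simpa using h.bind' h'

theorem Within.charge_bind {k : ℕ} {f : Unit → Comp β} {b : β} {K d : ℕ}
    (h : Within (f ()) b K d) : Within (charge k >>= f) b (k + K) d :=
  (within_charge k).bind h

theorem within_newArray (m : ℕ) (a : α) : Within (newArray m a) (fun _ => a) (m + 1) 0 :=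
  Within.charge_bind (K := 0) (within_pure _)

theorem within_readCell (A : ℕ → α) (i : ℕ) : Within (readCell A i) (A i) 1 0 :=
  Within.charge_bind (K := 0) (within_pure _)

theorem within_writeCell (A : ℕ → α) (i : ℕ) (a : α) :
    Within (writeCell A i a) (Function.update A i a) 1 0 :=
  Within.charge_bind (K := 0) (within_pure _)

theorem within_ite {P : Prop} [Decidable P] {c c' : Comp α} {a a' : α} {K d : ℕ}
    (h : P → Within c a K d) (h' : ¬ P → Within c' a' K d) :
    Within (if P then c else c') (if P then a else a') K d := by
  split_ifs with hP
  exacts [h hP, h' hP]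

/-- Folds, with the value tracked up to a relation with an abstract fold. -/
theorem within_foldlM_rel (R : β → γ → Prop) (f : β → α → Comp β) (g : γ → α → γ) (K : α → ℕ)
    (l : List α) (b : β) (c : γ) (hb : R b c)
    (h : ∀ a ∈ l, ∀ b c, R b c → ∃ b', Within (f b a) b' (K a) 0 ∧ R b' (g c a)) :
    ∃ b', Within (l.foldlM f b) b' (l.map K).sum 0 ∧ R b' (l.foldl g c) := by
  induction l generalizing b c with
  | nil => exact ⟨b, within_pure b, hb⟩
  | cons a l ih =>
    obtain ⟨b₁, h₁, hR₁⟩ := h a (by simp) b c hb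
    obtain ⟨b₂, h₂, hR₂⟩ := ih b₁ (g c a) hR₁ fun a' ha' => h a' (by simp [ha'])
    exact ⟨b₂, by simpa using h₁.bind h₂, by simpa using hR₂⟩

theorem within_foldlM (f : β → α → Comp β) (g : β → α → β) (K : α → ℕ) (l : List α) (b : β)
    (h : ∀ a ∈ l, ∀ b, Within (f b a) (g b a) (K a) 0) :
    Within (l.foldlM f b) (l.foldl g b) (l.map K).sum 0 := by
  obtain ⟨b', h', rfl⟩ := within_foldlM_rel (· = ·) f g K l b b rfl
    (by rintro a ha b _ rfl; exact ⟨_, h a ha b, rfl⟩)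
  exact h'

end Within

/-! ### More fuel does not change a result -/

/-- Wherever `c` halts, `c'` halts with the same result. -/
def Extends {α : Type} (c c' : Comp α) : Prop := ∀ s r, c.run s = some r → c'.run s = some r

section Extends
variable {α β : Type}

theorem Extends.refl (c : Comp α) : Extends c c := fun _ _ h => h

theorem Extends.bind {c c' : Comp α} {f f' : α → Comp β} (h : Extends c c')
    (hf : ∀ a, Extends (f a) (f' a)) : Extends (c >>= f) (c' >>= f') := by
  intro s r hr
  rw [StateT.run_bind] at hr ⊢
  obtain ⟨p, hp, hr⟩ := Option.bind_eq_some_iff.1 hr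
  exact Option.bind_eq_some_iff.2 ⟨p, h _ _ hp, hf _ _ _ hr⟩

theorem Extends.foldlM {f f' : β → α → Comp β} (l : List α) (b : β)
    (h : ∀ b a, Extends (f b a) (f' b a)) : Extends (l.foldlM f b) (l.foldlM f' b) := by
  induction l generalizing b with
  | nil => exact Extends.refl _
  | cons a l ih => exact (h b a).bind ih

theorem extends_failure (c : Comp α) : Extends failure c := by
  intro s r h
  cases h

/-- Fuel is consumed both by the loop and inside the recursive calls, so the loop has to be monotone
in its own fuel and in `sub` at once. -/
theorem extends_mainLoop {sub sub' : ℕ → List (List ℕ) → Comp (List (List ℕ))} (m : ℕ)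
    (B : ℕ → List (List ℕ)) (hs : ∀ i Δ, Extends (sub i Δ) (sub' i Δ)) {fuel fuel' : ℕ}
    (hf : fuel ≤ fuel') (Q : Tree) (out : List (List ℕ)) :
    Extends (mainLoop sub m B fuel Q out) (mainLoop sub' m B fuel' Q out) := by
  induction fuel generalizing fuel' Q out with
  | zero => exact extends_failure _
  | succ fuel ih =>
    obtain ⟨fuel', rfl⟩ : ∃ k, fuel' = k + 1 := ⟨fuel' - 1, by omega⟩
    unfold mainLoop
    refine (Extends.refl _).bind fun _ => (Extends.refl _).bind fun p => ?_
    rcases p with _ | ⟨t, Q⟩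
    · exact Extends.refl _
    · refine (Extends.refl _).bind fun A => (Extends.refl _).bind fun A => Extends.bind ?_ ?_
      · refine Extends.foldlM _ _ fun Q i => ?_
        refine (Extends.refl _).bind fun _ => (Extends.refl _).bind fun D =>
          (Extends.refl _).bind fun Δ => ?_
        split_ifs
        · exact Extends.refl _
        · refine (Extends.refl _).bind fun b => ?_
          split_ifs
          · exact Extends.refl _
          · exact (hs _ _).bind fun ρ => Extends.refl _
      · exact fun Q => ih (by omega) Q _

theorem extends_rDualize {fuel fuel' : ℕ} (hf : fuel ≤ fuel') (l m : ℕ) (φ : List (List ℕ)) :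
    Extends (rDualize fuel l m φ) (rDualize fuel' l m φ) := by
  induction fuel generalizing fuel' l m φ with
  | zero => exact extends_failure _
  | succ fuel ih =>
    obtain ⟨fuel', rfl⟩ : ∃ k, fuel' = k + 1 := ⟨fuel' - 1, by omega⟩
    unfold rDualize
    refine (Extends.refl _).bind fun _ => (Extends.refl _).bind fun _ =>
      (Extends.refl _).bind fun B => (Extends.refl _).bind fun A => (Extends.refl _).bind fun A =>
      (Extends.refl _).bind fun Q => ?_
    exact extends_mainLoop m B (fun i Δ => ih (by omega) _ _ _) (by omega) Q []

end Extends

/-! ### The lexicographic order -/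

/-- The lexicographic order of characteristic vectors. -/
def LexLt (s t : Finset ℕ) : Prop := ∃ i, i ∉ s ∧ i ∈ t ∧ ∀ j < i, j ∈ s ↔ j ∈ t

instance : IsStrictOrder (Finset ℕ) LexLt where
  irrefl := by rintro s ⟨i, h, h', -⟩; exact h h'
  trans := by
    rintro s t u ⟨i, hi, hi', h⟩ ⟨j, hj, hj', h'⟩
    rcases lt_trichotomy i j with hij | rfl | hij
    · exact ⟨i, hi, (h' i hij).1 hi', fun k hk => (h k hk).trans (h' k (hk.trans hij))⟩
    · exact absurd hi' hj
    · exact ⟨j, fun hs => hj ((h j hij).1 hs), hj',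
        fun k hk => (h k (hk.trans hij)).trans (h' k hk)⟩

/-- The first index below `i` at which the two sets differ lies in `t` only. All lexicographic
comparisons between a term and its successors reduce to this. -/
theorem lexLt_of_filter_ssubset {s t : Finset ℕ} {i : ℕ}
    (h : s.filter (· < i) ⊂ t.filter (· < i)) : LexLt s t := by
  classical
  obtain ⟨hsub, hne⟩ := h
  have hex : ∃ x, x ∈ t.filter (· < i) ∧ x ∉ s.filter (· < i) := by
    exact Set.not_subset.1 hne
  obtain ⟨hx, hx'⟩ := Nat.find_spec hex
  set x := Nat.find hex with hxdef
  simp only [Finset.mem_filter] at hx hx'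
  refine ⟨x, fun h => hx' ⟨h, hx.2⟩, hx.1, fun j hj => ?_⟩
  have hji : j < i := hj.trans hx.2
  constructor
  · intro h
    exact (Finset.mem_filter.1 (hsub (Finset.mem_filter.2 ⟨h, hji⟩))).1
  · intro h
    by_contra hs
    refine Nat.find_min hex hj ⟨Finset.mem_filter.2 ⟨h, hji⟩, fun h' => hs ?_⟩
    exact (Finset.mem_filter.1 h').1

/-! ### The queue -/

namespace Tree

/-- The terms in the tree, in lexicographic order. -/
def toList : ℕ → Tree → List (List ℕ)
  | _, .nil => []
  | _, .leaf => [[]]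
  | j, .node l r => toList (j + 1) r ++ (toList (j + 1) l).map (j :: ·)

/-- The tree has its leaves at height exactly `h`, and no node without sons. -/
def Ok : ℕ → Tree → Prop
  | _, .nil => True
  | h, .leaf => h = 0
  | 0, .node _ _ => False
  | h + 1, .node l r => Ok h l ∧ Ok h r ∧ (l ≠ .nil ∨ r ≠ .nil)

/-- This is the purpose of forbidding nodes without sons: removal fails only at an empty tree
itself, never after a long descent. -/
theorem toList_ne_nil {h j : ℕ} {T : Tree} (hT : Ok h T) (hne : T ≠ .nil) : toList j T ≠ [] := by
  induction T generalizing h j with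
  | nil => exact absurd rfl hne
  | leaf => simp [toList]
  | node l r ihl ihr =>
    cases h with
    | zero => exact hT.elim
    | succ h =>
      obtain ⟨hl, hr, hn⟩ := hT
      rcases hn with hn | hn
      · simp [toList, ihl hl hn]
      · simp [toList, ihr hr hn]

theorem mem_toList_bounds {h j : ℕ} {T : Tree} (hT : Ok h T) {t : List ℕ} (ht : t ∈ toList j T) :
    t.Pairwise (· < ·) ∧ ∀ x ∈ t, j ≤ x ∧ x < j + h := by
  induction T generalizing h j t with
  | nil => simp [toList] at ht
  | leaf => simp [toList] at ht; simp [ht]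
  | node l r ihl ihr =>
    cases h with
    | zero => exact hT.elim
    | succ h =>
      obtain ⟨hl, hr, -⟩ := hT
      simp only [toList, List.mem_append, List.mem_map] at ht
      rcases ht with ht | ⟨u, hu, rfl⟩
      · obtain ⟨h₁, h₂⟩ := ihr hr ht
        refine ⟨h₁, fun x hx => ?_⟩
        have := h₂ x hx
        omega
      · obtain ⟨h₁, h₂⟩ := ihl hl hu
        refine ⟨List.pairwise_cons.2 ⟨fun x hx => ?_, h₁⟩, fun x hx => ?_⟩
        · have := h₂ x hx
          omega
        · rcases List.mem_cons.1 hx with rfl | hx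
          · omega
          · have := h₂ x hx
            omega

theorem pairwise_toList {h j : ℕ} {T : Tree} (hT : Ok h T) :
    (toList j T).Pairwise fun t u => LexLt t.toFinset u.toFinset := by
  induction T generalizing h j with
  | nil => simp [toList]
  | leaf => simp [toList]
  | node l r ihl ihr =>
    cases h with
    | zero => exact hT.elim
    | succ h =>
      obtain ⟨hl, hr, -⟩ := hT
      refine List.pairwise_append.2 ⟨ihr hr, List.pairwise_map.2 ?_, ?_⟩
      · refine (ihl hl).imp_of_mem fun {t u} ht hu htu => ?_
        obtain ⟨i, hi, hi', hlt⟩ := htu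
        have hb := (mem_toList_bounds hl hu).2 i (by simpa using hi')
        refine ⟨i, ?_, ?_, fun k hk => ?_⟩
        · simp only [List.mem_toFinset, List.mem_cons, not_or] at hi ⊢
          exact ⟨by omega, hi⟩
        · simp only [List.mem_toFinset, List.mem_cons] at hi' ⊢
          exact Or.inr hi'
        · have := hlt k hk
          simp only [List.mem_toFinset, List.mem_cons] at this ⊢
          rw [this]
      · intro t ht _ hu
        obtain ⟨u, hv, rfl⟩ := List.mem_map.1 hu
        have ht' := (mem_toList_bounds hr ht).2
        have hu' := (mem_toList_bounds hl hv).2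
        refine ⟨j, fun h => ?_, by simp, fun k hk => ?_⟩
        · have := ht' j (by simpa using h)
          omega
        · have h₁ : k ∉ t := fun h => by have := ht' k h; omega
          have h₂ : k ∉ u := fun h => by have := hu' k h; omega
          simp [h₁, h₂, hk.ne]

theorem ok_join {h : ℕ} {l r : Tree} (hl : Ok h l) (hr : Ok h r) : Ok (h + 1) (join l r) := by
  cases l <;> cases r <;> simp_all [join, Ok]

theorem toList_join (j : ℕ) (l r : Tree) : toList j (join l r) = toList j (.node l r) := by
  cases l <;> cases r <;> simp [join, toList]

theorem ok_sons {h : ℕ} {T : Tree} (hT : Ok (h + 1) T) : Ok h T.sons.1 ∧ Ok h T.sons.2 := by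
  cases T with
  | nil => simp [sons, Ok]
  | leaf => simp [Ok] at hT
  | node l r => exact ⟨hT.1, hT.2.1⟩

theorem toList_sons {h : ℕ} (j : ℕ) {T : Tree} (hT : Ok (h + 1) T) :
    toList j (.node T.sons.1 T.sons.2) = toList j T := by
  cases T with
  | nil => simp [sons, toList]
  | leaf => simp [Ok] at hT
  | node l r => rfl

theorem within_popMin_nil (j : ℕ) : Within (popMin j .nil) none 1 0 := by
  unfold popMin
  exact Within.charge_bind (K := 0) (within_pure _)

/-- There is no backtracking: each level costs one step for its node and at most one more for an
empty right son, whence `2 * h + 1`. -/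
theorem within_popMin {h j : ℕ} {T : Tree} (hT : Ok h T) {t : List ℕ} {rest : List (List ℕ)}
    (ht : toList j T = t :: rest) :
    ∃ T', Within (popMin j T) (some (t, T')) (2 * h + 1) 0 ∧ Ok h T' ∧ toList j T' = rest := by
  induction T generalizing h j t rest with
  | nil => simp [toList] at ht
  | leaf =>
    simp only [toList, List.cons.injEq] at ht
    obtain ⟨rfl, rfl⟩ := ht
    refine ⟨.nil, ?_, by simp [Ok], by simp [toList]⟩
    unfold popMin
    exact Within.mono (Within.charge_bind (K := 0) (within_pure _)) (by omega)
  | node l r ihl ihr =>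
    cases h with
    | zero => exact hT.elim
    | succ h =>
      obtain ⟨hl, hr, hn⟩ := hT
      unfold popMin
      cases hR : toList (j + 1) r with
      | cons u us =>
        obtain ⟨r', hw, hok, hr'⟩ := ihr hr hR
        simp only [toList, hR, List.cons_append, List.cons.injEq] at ht
        obtain ⟨rfl, rfl⟩ := ht
        refine ⟨join l r', ?_, ok_join hl hok, by rw [toList_join, toList, hr']⟩
        refine (Within.charge_bind (hw.bind ?_)).mono
          (show 1 + ((2 * h + 1) + 0) ≤ _ by omega)
        exact within_pure _
      | nil =>
        have hrn : r = .nil := by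
          by_contra hne
          exact toList_ne_nil hr hne hR
        subst hrn
        cases hL : toList (j + 1) l with
        | nil => simp [toList, hL] at ht
        | cons u us =>
          obtain ⟨l', hw, hok, hl'⟩ := ihl hl hL
          simp only [toList, hL, List.nil_append, List.map_cons, List.cons.injEq] at ht
          obtain ⟨rfl, rfl⟩ := ht
          refine ⟨join l' .nil, ?_, ok_join hok (by simp [Ok]),
            by rw [toList_join]; simp [toList, hl']⟩
          refine (Within.charge_bind ((within_popMin_nil _).bind ?_)).mono
            (show 1 + (1 + ((2 * h + 1) + 0)) ≤ _ by omega)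
          refine hw.bind ?_
          exact within_pure _

/-- The tree is a set, so a term inserted repeatedly is stored once. That the result is nonempty is
needed in the induction, to see that the new node has a son. -/
theorem within_insert (A : ℕ → Bool) {h j : ℕ} {T : Tree} (hT : Ok h T) :
    ∃ T', Within (insert A h j T) T' (2 * h + 1) 0 ∧ Ok h T' ∧ T' ≠ .nil ∧
      ∀ t, t ∈ toList j T' ↔ t ∈ toList j T ∨ t = (List.range' j h).filter A := by
  induction h generalizing j T with
  | zero =>
    refine ⟨.leaf, ?_, rfl, by simp, fun t => ?_⟩
    · unfold insert
      exact Within.charge_bind (K := 0) (within_pure _)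
    · cases T with
      | nil => simp [toList]
      | leaf => simp [toList]
      | node l r => exact hT.elim
  | succ h ih =>
    obtain ⟨hl, hr⟩ := ok_sons hT
    unfold insert
    cases hA : A j with
    | true =>
      obtain ⟨T', hw, hok, hne, hmem⟩ := ih (j := j + 1) hl
      refine ⟨.node T' T.sons.2, ?_, ⟨hok, hr, Or.inl hne⟩, by simp, fun t => ?_⟩
      · refine (Within.charge_bind ((within_readCell A j).bind ?_)).mono
          (show 1 + (1 + ((2 * h + 1) + 0)) ≤ _ by omega)
        simp only [hA, if_true]
        exact hw.bind (within_pure _)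
      · rw [← toList_sons j hT]
        simp only [toList, List.mem_append, List.mem_map, hmem, List.range'_succ,
          List.filter_cons_of_pos hA]
        constructor
        · rintro (h | ⟨u, hu | rfl, rfl⟩)
          exacts [.inl (.inl h), .inl (.inr ⟨u, hu, rfl⟩), .inr rfl]
        · rintro ((h | ⟨u, hu, rfl⟩) | rfl)
          exacts [.inl h, .inr ⟨u, .inl hu, rfl⟩, .inr ⟨_, .inr rfl, rfl⟩]
    | false =>
      obtain ⟨T', hw, hok, hne, hmem⟩ := ih (j := j + 1) hr
      refine ⟨.node T.sons.1 T', ?_, ⟨hl, hok, Or.inr hne⟩, by simp, fun t => ?_⟩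
      · refine (Within.charge_bind ((within_readCell A j).bind ?_)).mono
          (show 1 + (1 + ((2 * h + 1) + 0)) ≤ _ by omega)
        simp only [hA]
        exact hw.bind (within_pure _)
      · rw [← toList_sons j hT]
        have hA' : ¬ A j = true := by simp [hA]
        simp only [toList, List.mem_append, hmem, List.range'_succ,
          List.filter_cons_of_neg hA']
        tauto

end Tree

/-! ### Substeps: results and costs -/

/-- A monotone CNF over the variables `0, …, m - 1` without empty clause. -/
structure Valid (m : ℕ) (φ : List (List ℕ)) : Prop where
  ne_nil : ∀ c ∈ φ, c ≠ []
  nodup : ∀ c ∈ φ, c.Nodup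
  lt : ∀ c ∈ φ, ∀ x ∈ c, x < m

/-- `i` is the largest variable of the clause. -/
def IsTop (i : ℕ) (c : List ℕ) : Prop := i ∈ c ∧ ∀ x ∈ c, x ≤ i

theorem IsTop.unique {i j : ℕ} {c : List ℕ} (h : IsTop i c) (h' : IsTop j c) : i = j :=
  le_antisymm (h'.2 i h.1) (h.2 j h'.1)

/-- Cell `i` of `B` holds the clauses with largest variable `i`. -/
structure IsBuckets (m : ℕ) (φ : List (List ℕ)) (B : ℕ → List (List ℕ)) : Prop where
  mem : ∀ i c, c ∈ B i ↔ c ∈ φ ∧ IsTop i c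
  sum : ∑ i ∈ Finset.range m, size (B i) = size φ

/-- The array `A` is the characteristic vector of `t`. -/
def Rep (A : ℕ → Bool) (t : Finset ℕ) : Prop := ∀ x, A x = true ↔ x ∈ t

theorem size_cons (c : List ℕ) (φ : List (List ℕ)) : size (c :: φ) = c.length + size φ := by
  simp [size]

/-- A nonempty clause has a literal to which the constant overhead of the clause can be charged. -/
theorem sum_map_le_of_length (a b : ℕ) {φ : List (List ℕ)} (h : ∀ c ∈ φ, c ≠ []) :
    (φ.map fun c => a + b * c.length).sum ≤ (a + b) * size φ := by
  induction φ with
  | nil => simp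
  | cons c φ ih =>
    have h₁ := ih fun c hc => h c (by simp [hc])
    have h₂ : 1 ≤ c.length := List.length_pos_of_ne_nil (h c (by simp))
    rw [List.map_cons, List.sum_cons, size_cons]
    nlinarith

/-- Work on distinct buckets is bounded by work on all of them, and the sizes of all buckets add up
to the size of the formula. -/
theorem sum_map_le_sum_range {m : ℕ} (f : ℕ → ℕ) {l : List ℕ} (hl : l.Nodup)
    (hm : ∀ x ∈ l, x < m) : (l.map f).sum ≤ ∑ i ∈ Finset.range m, f i := by
  rw [← List.sum_toFinset f hl]
  exact Finset.sum_le_sum_of_subset fun x hx => by simpa using hm x (by simpa using hx)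

theorem length_le_of_lt {m : ℕ} {l : List ℕ} (hl : l.Nodup) (hm : ∀ x ∈ l, x < m) :
    l.length ≤ m := by
  simpa using sum_map_le_sum_range (fun _ => 1) hl hm

/-- Several loops below are verified against the list of items treated so far; this evaluates that
list at the end of the loop. -/
theorem foldl_append_singleton {α : Type} (l S : List α) :
    l.foldl (fun S c => S ++ [c]) S = S ++ l := by
  induction l generalizing S with
  | nil => simp
  | cons a l ih => simp [ih]

theorem mem_foldl_append {α : Type} (B : ℕ → List α) (l : List ℕ) (S : List α) (c : α) :
    c ∈ l.foldl (fun S j => S ++ B j) S ↔ c ∈ S ∨ ∃ j ∈ l, c ∈ B j := by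
  induction l generalizing S with
  | nil => simp
  | cons a l ih => rw [List.foldl_cons, ih]; simp [or_assoc]

theorem forall_mem_append_singleton {α : Type} {P : α → Prop} {l : List α} {a : α} :
    (∀ c ∈ l ++ [a], P c) ↔ (∀ c ∈ l, P c) ∧ P a := by
  simp only [List.mem_append, List.mem_singleton]
  constructor
  · exact fun h => ⟨fun c hc => h c (.inl hc), h a (.inr rfl)⟩
  · rintro ⟨h, h'⟩ c (hc | rfl)
    exacts [h c hc, h']

theorem within_maxVar {c : List ℕ} (hc : c ≠ []) :
    ∃ i, Within (maxVar c) i c.length 0 ∧ IsTop i c := by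
  refine ⟨c.foldl max 0, ?_, ?_⟩
  · have := within_foldlM (fun b x => (do charge 1; pure (max b x) : Comp ℕ)) max (fun _ => 1) c 0
      fun a _ b => Within.charge_bind (K := 0) (within_pure _)
    exact Within.mono this (by simp)
  · have key : ∀ (c : List ℕ) (b : ℕ), (c.foldl max b = b ∨ c.foldl max b ∈ c) ∧
        b ≤ c.foldl max b ∧ ∀ x ∈ c, x ≤ c.foldl max b := by
      intro c
      induction c with
      | nil => simp
      | cons a c ih =>
        intro b
        obtain ⟨h₁, h₂, h₃⟩ := ih (max b a)
        refine ⟨?_, (le_max_left _ _).trans h₂, ?_⟩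
        · rcases h₁ with h₁ | h₁
          · rw [List.foldl_cons, h₁]
            rcases max_cases b a with h | h
            · exact Or.inl h.1
            · exact Or.inr (by simp [h.1])
          · exact Or.inr (by simp only [List.foldl_cons]; exact List.mem_cons_of_mem _ h₁)
        · rintro x (_ | ⟨_, hx⟩)
          · exact (le_max_right _ _).trans h₂
          · exact h₃ x hx
    obtain ⟨h₁, -, h₃⟩ := key c 0
    refine ⟨?_, h₃⟩
    rcases h₁ with h₁ | h₁
    -- The fold returned its start value 0, so the first variable is 0 and the start value does
    -- occur in the clause.
    · obtain ⟨a, c, rfl⟩ := List.exists_cons_of_ne_nil hc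
      have := h₃ a (by simp)
      rw [h₁] at this ⊢
      simp [Nat.le_zero.1 this]
    · exact h₁

theorem within_buckets {m : ℕ} {φ : List (List ℕ)} (hφ : Valid m φ) :
    ∃ B, Within (buckets m φ) B (m + 1 + 4 * size φ) 0 ∧ IsBuckets m φ B := by
  obtain ⟨B, hw, hR⟩ := within_foldlM_rel
    (R := fun (B : ℕ → List (List ℕ)) (S : List (List ℕ)) =>
      (∀ i c, c ∈ B i ↔ c ∈ S ∧ IsTop i c) ∧
      ∑ i ∈ Finset.range m, size (B i) = size S)
    (f := fun (B : ℕ → List (List ℕ)) (c : List ℕ) => (do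
      charge 1
      let i ← maxVar c
      let D ← readCell B i
      writeCell B i (c :: D) : Comp (ℕ → List (List ℕ))))
    (g := fun S c => S ++ [c]) (fun c => 3 + 1 * c.length) φ (fun _ => []) []
    ⟨by simp, by simp [size]⟩ (by
      rintro c hc B S ⟨h₁, h₂⟩
      obtain ⟨i, hi, htop⟩ := within_maxVar (hφ.ne_nil c hc)
      refine ⟨Function.update B i (c :: B i), ?_, fun j d => ?_, ?_⟩
      · exact (Within.charge_bind (hi.bind ((within_readCell B i).bind
          (within_writeCell B i (c :: B i))))).mono (by omega)
      · by_cases hj : j = i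
        · subst hj
          simp only [Function.update_self, List.mem_cons, h₁, List.mem_append, List.not_mem_nil,
            or_false]
          constructor
          · rintro (rfl | h)
            exacts [⟨.inr rfl, htop⟩, ⟨.inl h.1, h.2⟩]
          · rintro ⟨h | rfl, h'⟩
            exacts [.inr ⟨h, h'⟩, .inl rfl]
        · simp only [Function.update_of_ne hj, h₁, List.mem_append, List.mem_singleton]
          constructor
          · exact fun h => ⟨.inl h.1, h.2⟩
          · rintro ⟨h | rfl, h'⟩
            exacts [⟨h, h'⟩, absurd (h'.unique htop) hj]
      · have hmem : i ∈ Finset.range m := Finset.mem_range.2 (hφ.lt c hc i htop.1)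
        have hupd : (fun j => size (Function.update B i (c :: B i) j)) =
            Function.update (fun j => size (B j)) i (c.length + size (B i)) := by
          funext j
          by_cases hj : j = i
          · subst hj; simp [size_cons]
          · simp [Function.update_of_ne hj]
        rw [hupd, Finset.sum_update_of_mem hmem]
        have h₃ := Finset.add_sum_erase _ (fun j => size (B j)) hmem
        rw [← Finset.sdiff_singleton_eq_erase] at h₃
        have h₄ : size (S ++ [c]) = size S + c.length := by simp [size]
        omega)
  rw [foldl_append_singleton, List.nil_append] at hR
  have hs := sum_map_le_of_length 3 1 hφ.ne_nil
  exact ⟨B, ((within_newArray m []).bind hw).mono (by omega), hR.1, hR.2⟩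

theorem rep_empty : Rep (fun _ => false) ∅ := fun x => by simp

theorem Rep.insert {A : ℕ → Bool} {t : Finset ℕ} (h : Rep A t) (i : ℕ) :
    Rep (Function.update A i true) (insert i t) := by
  intro x
  by_cases hx : x = i
  · subst hx; simp
  · simp [h x, hx]

theorem within_markAll {A : ℕ → Bool} {s : Finset ℕ} (hA : Rep A s) (t : List ℕ) :
    ∃ A', Within (markAll A t) A' (2 * t.length) 0 ∧ Rep A' (s ∪ t.toFinset) := by
  obtain ⟨A', hw, hR⟩ := within_foldlM_rel Rep
    (f := fun A x => (do charge 1; writeCell A x true : Comp (ℕ → Bool)))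
    (g := fun s x => insert x s) (fun _ => 2) t A s hA
    fun x _ A s h => ⟨_, Within.mono (Within.charge_bind (within_writeCell A x true)) (le_refl 2), h.insert x⟩
  refine ⟨A', hw.mono (by simp [mul_comm]), ?_⟩
  convert hR using 1
  clear hw hR hA
  induction t generalizing s with
  | nil => simp
  | cons a t ih =>
    rw [List.foldl_cons, ← ih]
    ext x
    simp only [List.toFinset_cons, Finset.mem_union, Finset.mem_insert]
    tauto

theorem within_before (i : ℕ) (t : List ℕ) :
    Within (before i t) (t.filter (· < i)) t.length 0 := by
  induction t with
  | nil => exact within_pure _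
  | cons x t ih =>
    unfold before
    refine (Within.charge_bind (ih.bind ?_)).mono
      (show 1 + (t.length + 0) ≤ _ by simp [add_comm])
    have h := within_pure (if x < i then x :: t.filter (· < i) else t.filter (· < i))
    rwa [show (x :: t).filter (· < i) =
      if x < i then x :: t.filter (· < i) else t.filter (· < i) by
        split_ifs with hx <;> simp [hx]]

theorem within_strip (i : ℕ) (c : List ℕ) :
    Within (strip i c) (c.filter (· ≠ i)) c.length 0 := by
  induction c with
  | nil => exact within_pure _
  | cons x t ih =>
    unfold strip
    refine (Within.charge_bind (ih.bind ?_)).mono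
      (show 1 + (t.length + 0) ≤ _ by simp [add_comm])
    have h := within_pure (if x = i then t.filter (· ≠ i) else x :: t.filter (· ≠ i))
    rwa [show (x :: t).filter (· ≠ i) =
      if x = i then t.filter (· ≠ i) else x :: t.filter (· ≠ i) by
        split_ifs with hx <;> simp [hx]]

theorem within_meets (A : ℕ → Bool) (c : List ℕ) :
    Within (meets A c) (c.any A) (2 * c.length) 0 := by
  have h := within_foldlM
    (fun b x => (do charge 1; let a ← readCell A x; pure (b || a) : Comp Bool))
    (fun b x => b || A x) (fun _ => 2) c false fun x _ b =>
      Within.mono (Within.charge_bind ((within_readCell A x).bind (K' := 0) (within_pure _)))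
        (le_refl 2)
  have key : ∀ (c : List ℕ) (b : Bool), c.foldl (fun b x => b || A x) b = (b || c.any A) := by
    intro c
    induction c with
    | nil => simp
    | cons a c ih => intro b; simp [ih, Bool.or_assoc]
  rw [key, Bool.false_or] at h
  exact Within.mono h (by simp [mul_comm])

/-- `Δ` lists the clauses `c` without a variable of `t` such that `c ∨ x_i` is a clause of `φ` with
largest variable `i`. -/
def IsReduct (φ : List (List ℕ)) (i : ℕ) (t : Finset ℕ) (Δ : List (List ℕ)) : Prop :=
  ∀ r, r ∈ Δ ↔ ∃ c ∈ φ, IsTop i c ∧ r = c.filter (· ≠ i) ∧ ∀ x ∈ r, x ∉ t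

theorem within_reduct {m : ℕ} {φ : List (List ℕ)} {B : ℕ → List (List ℕ)} (hφ : Valid m φ)
    (hB : IsBuckets m φ B) (i : ℕ) {A : ℕ → Bool} {t : Finset ℕ} (hA : Rep A t) :
    ∃ Δ, Within (reduct i (B i) A) Δ (4 * size (B i)) 0 ∧ IsReduct φ i t Δ ∧
      size Δ ≤ size (B i) ∧ Δ.length ≤ size (B i) := by
  obtain ⟨Δ, hw, h₁, h₂⟩ := within_foldlM_rel
    (R := fun (Δ : List (List ℕ)) (S : List (List ℕ)) =>
      (∀ r, r ∈ Δ ↔ ∃ c ∈ S, r = c.filter (· ≠ i) ∧ ∀ x ∈ r, x ∉ t) ∧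
      size Δ ≤ size S ∧ Δ.length ≤ S.length)
    (f := fun (Δ : List (List ℕ)) (c : List ℕ) => (do
      charge 1
      let r ← strip i c
      let b ← meets A r
      pure (if b then Δ else r :: Δ) : Comp (List (List ℕ))))
    (g := fun S c => S ++ [c]) (fun c => 1 + 3 * c.length) (B i) [] []
    ⟨by simp, by simp [size], by simp⟩ (by
      rintro c hc Δ S ⟨h₁, h₂, h₃⟩
      refine ⟨if (c.filter (· ≠ i)).any A then Δ else c.filter (· ≠ i) :: Δ, ?_, ?_⟩
      · refine (Within.charge_bind ((within_strip i c).bind ((within_meets A _).bind (K' := 0)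
          ?_))).mono ?_
        · exact within_pure _
        have := List.length_filter_le (· ≠ i) c
        omega
      · have hiff : (c.filter (· ≠ i)).any A = true ↔ ¬ ∀ x ∈ c.filter (· ≠ i), x ∉ t := by
          simp only [List.any_eq_true, hA _]
          push Not
          rfl
        have hlen := List.length_filter_le (· ≠ i) c
        have h₄ : size (S ++ [c]) = size S + c.length := by simp [size]
        by_cases h : (c.filter (· ≠ i)).any A = true
        · rw [if_pos h]
          refine ⟨fun r => ?_, by omega, by simp; omega⟩
          rw [h₁]
          constructor
          · rintro ⟨c', hc', h'⟩
            exact ⟨c', by simp [hc'], h'⟩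
          · rintro ⟨c', hc', rfl, h'⟩
            rcases List.mem_append.1 hc' with hc' | hc'
            · exact ⟨c', hc', rfl, h'⟩
            · rw [List.mem_singleton.1 hc'] at h'
              exact absurd h' (hiff.1 h)
        · rw [if_neg h]
          refine ⟨fun r => ?_, by rw [size_cons]; omega, by simp; omega⟩
          rw [List.mem_cons, h₁]
          rw [hiff, not_not] at h
          constructor
          · rintro (rfl | ⟨c', hc', h'⟩)
            · exact ⟨c, by simp, rfl, h⟩
            · exact ⟨c', by simp [hc'], h'⟩
          · rintro ⟨c', hc', rfl, h'⟩
            rcases List.mem_append.1 hc' with hc' | hc'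
            · exact Or.inr ⟨c', hc', rfl, h'⟩
            · rw [List.mem_singleton.1 hc']
              exact Or.inl rfl)
  rw [foldl_append_singleton, List.nil_append] at h₁ h₂
  have hne : ∀ c ∈ B i, c ≠ [] := fun c hc => hφ.ne_nil c ((hB.mem i c).1 hc).1
  refine ⟨Δ, hw.mono (sum_map_le_of_length 1 3 hne), fun r => ?_, h₂.1, ?_⟩
  · rw [h₁]
    constructor
    · rintro ⟨c, hc, h⟩
      exact ⟨c, ((hB.mem i c).1 hc).1, ((hB.mem i c).1 hc).2, h⟩
    · rintro ⟨c, hc, hi, h⟩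
      exact ⟨c, (hB.mem i c).2 ⟨hc, hi⟩, h⟩
  · have := sum_map_le_of_length 1 0 hne
    simp at this
    omega

theorem within_hasEmptyClause (Δ : List (List ℕ)) :
    Within (hasEmptyClause Δ) (Δ.any List.isEmpty) Δ.length 0 := by
  have h := within_foldlM (fun b c => (do charge 1; pure (b || c.isEmpty) : Comp Bool))
    (fun b c => b || c.isEmpty) (fun _ => 1) Δ false fun x _ b =>
      Within.charge_bind (K := 0) (within_pure _)
  have key : ∀ (c : List (List ℕ)) (b : Bool),
      c.foldl (fun b x => b || x.isEmpty) b = (b || c.any List.isEmpty) := by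
    intro c
    induction c with
    | nil => simp
    | cons a c ih => intro b; simp [ih, Bool.or_assoc]
  rw [key, Bool.false_or] at h
  exact Within.mono h (by simp)

open Classical in
/-- Add `i` to the term if a clause with largest variable `i` is missed. -/
noncomputable def greedyStep (φ : List (List ℕ)) (t : Finset ℕ) (i : ℕ) : Finset ℕ :=
  if ∃ c ∈ φ, IsTop i c ∧ ∀ x ∈ c, x ∉ t then insert i t else t

/-- The greedy completion of `t` on the variables `j, …, j + h - 1`. -/
noncomputable def greedy (φ : List (List ℕ)) (t : Finset ℕ) (j h : ℕ) : Finset ℕ :=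
  (List.range' j h).foldl (greedyStep φ) t

theorem within_complete {m : ℕ} {φ : List (List ℕ)} {B : ℕ → List (List ℕ)} (hφ : Valid m φ)
    (hB : IsBuckets m φ B) {A : ℕ → Bool} {t : Finset ℕ} (hA : Rep A t) {j h : ℕ}
    (hjh : j + h ≤ m) :
    ∃ A', Within (complete B A j h) A' (3 * m + 3 * size φ) 0 ∧ Rep A' (greedy φ t j h) := by
  obtain ⟨A', hw, hR⟩ := within_foldlM_rel Rep
    (f := fun A i => (do
      charge 1
      let D ← readCell B i
      let needed ← D.foldlM (fun b c => do
        charge 1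
        let a ← meets A c
        pure (b || !a)) false
      if needed then writeCell A i true else pure A : Comp (ℕ → Bool)))
    (g := greedyStep φ) (fun i => 3 + 3 * size (B i)) (List.range' j h) A t hA (by
      intro i hi A t hA
      have hne : ∀ c ∈ B i, c ≠ [] := fun c hc => hφ.ne_nil c ((hB.mem i c).1 hc).1
      have h₁ := within_foldlM (fun b c => (do
          charge 1
          let a ← meets A c
          pure (b || !a) : Comp Bool))
        (fun b c => b || !c.any A) (fun c => 1 + 2 * c.length) (B i) false fun c _ b =>
          (Within.charge_bind ((within_meets A c).bind (K' := 0) (within_pure _)))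
      have key : ∀ (D : List (List ℕ)) (b : Bool),
          D.foldl (fun b c => b || !c.any A) b = (b || D.any fun c => !c.any A) := by
        intro c
        induction c with
        | nil => simp
        | cons a c ih => intro b; rw [List.foldl_cons, ih, List.any_cons, Bool.or_assoc]
      rw [key, Bool.false_or] at h₁
      have hiff : ((B i).any fun c => !c.any A) = true ↔
          ∃ c ∈ φ, IsTop i c ∧ ∀ x ∈ c, x ∉ t := by
        rw [List.any_eq_true]
        refine exists_congr fun c => ?_
        rw [hB.mem, and_assoc, Bool.not_eq_true', ← Bool.not_eq_true, List.any_eq_true]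
        simp only [hA _, not_exists, not_and]
      have hs := sum_map_le_of_length 1 2 hne
      refine ⟨if ((B i).any fun c => !c.any A) = true then Function.update A i true else A, ?_, ?_⟩
      · refine (Within.charge_bind ((within_readCell B i).bind (h₁.bind ?_))).mono
          (show 1 + (1 + (_ + 1)) ≤ _ by omega)
        exact within_ite (fun _ => within_writeCell A i true)
          fun _ => (within_pure A).mono (by omega)
      · unfold greedyStep
        by_cases hn : ((B i).any fun c => !c.any A) = true
        · rw [if_pos hn, if_pos (hiff.1 hn)]
          exact hA.insert i
        · rw [if_neg hn, if_neg (mt hiff.2 hn)]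
          exact hA)
  refine ⟨A', hw.mono ((sum_map_le_sum_range (m := m) _ (List.nodup_range' ..) ?_).trans ?_), hR⟩
  · intro x hx
    rw [List.mem_range'_1] at hx
    omega
  · rw [Finset.sum_add_distrib, ← Finset.mul_sum, hB.sum]
    simp [mul_comm]

/-- `t` meets every clause. -/
def Hits (φ : List (List ℕ)) (t : Finset ℕ) : Prop := ∀ c ∈ φ, ∃ x ∈ c, x ∈ t

/-- `t` meets every clause, and every variable of `t` is the only one of `t` in some clause. -/
def MinHit (φ : List (List ℕ)) (t : Finset ℕ) : Prop :=
  Hits φ t ∧ ∀ x ∈ t, ∃ c ∈ φ, x ∈ c ∧ ∀ y ∈ c, y ∈ t → y = x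

/-- The clauses with all variables below `i`. -/
def low (φ : List (List ℕ)) (i : ℕ) : List (List ℕ) := φ.filter fun c => ∀ x ∈ c, x < i

theorem mem_low {φ : List (List ℕ)} {i : ℕ} {c : List ℕ} :
    c ∈ low φ i ↔ c ∈ φ ∧ ∀ x ∈ c, x < i := by
  simp [low]

theorem exists_isTop {c : List ℕ} (hc : c ≠ []) : ∃ i, IsTop i c := by
  obtain ⟨i, -, h⟩ := within_maxVar hc
  exact ⟨i, h⟩

theorem within_countHits (A : ℕ → Bool) (c : List ℕ) :
    Within (countHits A c) ((c.filter A).length, (c.filter A).getLastD 0) (2 * c.length) 0 := by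
  have h := within_foldlM (fun p x => (do
        charge 1
        let a ← readCell A x
        pure (if a then (p.1 + 1, x) else p) : Comp (ℕ × ℕ)))
    (fun p x => if A x then (p.1 + 1, x) else p) (fun _ => 2) c (0, 0) fun x _ b =>
      Within.mono (Within.charge_bind ((within_readCell A x).bind (K' := 0) (within_pure _)))
        (le_refl 2)
  have key : ∀ (c : List ℕ) (p : ℕ × ℕ),
      c.foldl (fun p x => if A x then (p.1 + 1, x) else p) p =
        (p.1 + (c.filter A).length, (c.filter A).getLastD p.2) := by
    intro c
    induction c with
    | nil => simp
    | cons a c ih =>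
      intro p
      rw [List.foldl_cons, ih]
      cases hA : A a
      · simp [hA]
      · simp only [if_true, List.filter_cons_of_pos hA, List.length_cons, List.getLastD_cons]
        rw [add_assoc, add_comm 1]
  rw [key, Nat.zero_add] at h
  exact Within.mono h (by simp [mul_comm])

theorem filter_eq_singleton_iff {A : ℕ → Bool} {c : List ℕ} (hc : c.Nodup) {x : ℕ} :
    c.filter A = [x] ↔ (x ∈ c ∧ A x = true) ∧ ∀ y ∈ c, A y = true → y = x := by
  constructor
  · intro h
    have hm : ∀ y, (y ∈ c ∧ A y = true) ↔ y = x := by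
      intro y
      rw [← List.mem_filter, h, List.mem_singleton]
    exact ⟨(hm x).2 rfl, fun y hy hA => (hm y).1 ⟨hy, hA⟩⟩
  · rintro ⟨⟨hx, hA⟩, h⟩
    refine List.perm_singleton.1 ((List.perm_ext_iff_of_nodup (hc.filter _) (by simp)).2 ?_)
    intro y
    rw [List.mem_filter, List.mem_singleton]
    constructor
    · exact fun hy => h y hy.1 hy.2
    · rintro rfl
      exact ⟨hx, hA⟩

theorem within_isPrimePrefix {m : ℕ} {φ : List (List ℕ)} {B : ℕ → List (List ℕ)} (hφ : Valid m φ)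
    (hB : IsBuckets m φ B) {A : ℕ → Bool} {u : List ℕ} (hA : Rep A u.toFinset) {i : ℕ}
    (hi : i < m) :
    ∃ b, Within (isPrimePrefix m B i u A) b (3 * m + 1 + 4 * size φ + 2 * u.length) 0 ∧
      (b = true ↔ MinHit (low φ (i + 1)) u.toFinset) := by
  -- Loop invariant: the flag says that all clauses treated so far are met, and a variable is marked
  -- iff it is the only hit of one of them. The last hit reported by `countHits` is used only when
  -- there is exactly one, so its default value is harmless.
  obtain ⟨p, hw, hR⟩ := within_foldlM_rel
    (R := fun (p : Bool × (ℕ → Bool)) (S : List (List ℕ)) =>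
      (p.1 = true ↔ ∀ c ∈ S, (c.filter A).length ≠ 0) ∧
      ∀ x, p.2 x = true ↔ ∃ c ∈ S, c.filter A = [x])
    (f := fun (p : Bool × (ℕ → Bool)) j => (do
      charge 1
      let D ← readCell B j
      D.foldlM (fun (p : Bool × (ℕ → Bool)) c => do
        charge 1
        let q ← countHits A c
        if q.1 = 0 then
          pure (false, p.2)
        else if q.1 = 1 then
          pure (p.1, ← writeCell p.2 q.2 true)
        else
          pure p) p : Comp (Bool × (ℕ → Bool))))
    (g := fun S j => S ++ B j) (fun j => 2 + 4 * size (B j)) (List.range (i + 1))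
    (true, fun _ => false) [] ⟨by simp, by simp⟩ (by
      intro j hj p S hR
      have hne : ∀ c ∈ B j, c ≠ [] := fun c hc => hφ.ne_nil c ((hB.mem j c).1 hc).1
      obtain ⟨p', hw, hR'⟩ := within_foldlM_rel
        (R := fun (p : Bool × (ℕ → Bool)) (S : List (List ℕ)) =>
          (p.1 = true ↔ ∀ c ∈ S, (c.filter A).length ≠ 0) ∧
          ∀ x, p.2 x = true ↔ ∃ c ∈ S, c.filter A = [x])
        (f := fun (p : Bool × (ℕ → Bool)) c => (do
          charge 1
          let q ← countHits A c
          if q.1 = 0 then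
            pure (false, p.2)
          else if q.1 = 1 then
            pure (p.1, ← writeCell p.2 q.2 true)
          else
            pure p : Comp (Bool × (ℕ → Bool))))
        (g := fun S c => S ++ [c]) (fun c => 2 + 2 * c.length) (B j) p S hR (by
          rintro c hc ⟨b, X⟩ S ⟨h₁, h₂⟩
          have hq := within_countHits A c
          by_cases h0 : (c.filter A).length = 0
          · refine ⟨(false, X), ?_, ?_, ?_⟩
            · refine (Within.charge_bind (hq.bind (K' := 0) ?_)).mono (by omega)
              rw [if_pos h0]
              exact within_pure _
            · simp only [Bool.false_eq_true, false_iff]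
              exact fun h => h c (by simp) h0
            · intro x
              rw [h₂]
              refine exists_congr fun c' => ?_
              simp only [List.mem_append, List.mem_singleton]
              constructor
              · exact fun h => ⟨.inl h.1, h.2⟩
              · rintro ⟨h | rfl, h'⟩
                · exact ⟨h, h'⟩
                · simp [h'] at h0
          · have hfst : ∀ X : ℕ → Bool, ((b, X).1 = true ↔ ∀ c' ∈ S ++ [c], (c'.filter A).length ≠ 0) := by
              intro X
              refine h₁.trans ?_
              rw [forall_mem_append_singleton]
              exact ⟨fun h => ⟨h, h0⟩, fun h => h.1⟩
            by_cases h1 : (c.filter A).length = 1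
            · obtain ⟨y, hy⟩ := List.length_eq_one_iff.1 h1
              refine ⟨(b, Function.update X y true), ?_, hfst _, ?_⟩
              · refine (Within.charge_bind (hq.bind (K' := 1) ?_)).mono (by omega)
                rw [if_neg h0, if_pos h1, hy]
                exact (within_writeCell X y true).bind (K' := 0) (within_pure _)
              · intro x
                by_cases hx : x = y
                · subst hx
                  simp only [Function.update_self, true_iff]
                  exact ⟨c, by simp, hy⟩
                · simp only [Function.update_of_ne hx, h₂ x]
                  refine exists_congr fun c' => ?_
                  simp only [List.mem_append, List.mem_singleton]
                  constructor
                  · exact fun h => ⟨.inl h.1, h.2⟩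
                  · rintro ⟨h | rfl, h'⟩
                    · exact ⟨h, h'⟩
                    · rw [hy] at h'
                      simp at h'
                      exact absurd h'.symm hx
            · refine ⟨(b, X), ?_, hfst _, ?_⟩
              · refine (Within.charge_bind (hq.bind (K' := 0) ?_)).mono (by omega)
                rw [if_neg h0, if_neg h1]
                exact within_pure _
              · intro x
                rw [h₂]
                refine exists_congr fun c' => ?_
                simp only [List.mem_append, List.mem_singleton]
                constructor
                · exact fun h => ⟨.inl h.1, h.2⟩
                · rintro ⟨h | rfl, h'⟩
                  · exact ⟨h, h'⟩
                  · simp [h'] at h1)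
      rw [foldl_append_singleton] at hR'
      have hs := sum_map_le_of_length 2 2 hne
      exact ⟨p', (Within.charge_bind ((within_readCell B j).bind hw)).mono (by omega), hR'⟩)
  have hw₂ := within_foldlM (fun b x => (do
      charge 1
      let a ← readCell p.2 x
      pure (b && a) : Comp Bool)) (fun b x => b && p.2 x) (fun _ => 2) u p.1 fun x _ b =>
      Within.mono (Within.charge_bind ((within_readCell p.2 x).bind (K' := 0) (within_pure _)))
        (le_refl 2)
  have key : ∀ (u : List ℕ) (b : Bool), u.foldl (fun b x => b && p.2 x) b = (b && u.all p.2) := by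
    intro c
    induction c with
    | nil => simp
    | cons a c ih => intro b; simp [ih, Bool.and_assoc]
  rw [key] at hw₂
  have hmem : ∀ c, c ∈ (List.range (i + 1)).foldl (fun S j => S ++ B j) [] ↔
      c ∈ low φ (i + 1) := by
    intro c
    rw [mem_foldl_append, mem_low]
    simp only [List.not_mem_nil, false_or, List.mem_range, hB.mem]
    constructor
    · rintro ⟨j, hj, hc, htop⟩
      exact ⟨hc, fun x hx => (htop.2 x hx).trans_lt hj⟩
    · rintro ⟨hc, hlt⟩
      obtain ⟨j, hj⟩ := exists_isTop (hφ.ne_nil c hc)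
      exact ⟨j, hlt j hj.1, hc, hj⟩
  simp only [hmem] at hR
  refine ⟨p.1 && u.all p.2, ?_, ?_⟩
  · refine ((within_newArray m false).bind (hw.bind hw₂)).mono ?_
    have h₁ : ((List.range (i + 1)).map fun j => 2 + 4 * size (B j)).sum ≤ _ :=
      sum_map_le_sum_range (m := m) _ List.nodup_range (by
        intro x hx
        rw [List.mem_range] at hx
        omega)
    rw [Finset.sum_add_distrib, ← Finset.mul_sum, hB.sum, Finset.sum_const, Finset.card_range,
      smul_eq_mul] at h₁
    have h₂ : (u.map fun _ => 2).sum = 2 * u.length := by simp [mul_comm]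
    omega
  · rw [Bool.and_eq_true, hR.1, List.all_eq_true]
    refine and_congr ?_ ?_
    · refine forall₂_congr fun c _ => ?_
      rw [← Nat.pos_iff_ne_zero, List.length_pos_iff_exists_mem]
      refine exists_congr fun x => ?_
      rw [List.mem_filter, hA x]
    · simp only [List.mem_toFinset]
      refine forall₂_congr fun x hx => ?_
      rw [hR.2]
      refine exists_congr fun c => and_congr_right fun hc => ?_
      rw [filter_eq_singleton_iff (hφ.nodup c (mem_low.1 hc).1)]
      simp only [hA _, List.mem_toFinset, hx, and_true]

/-! ### Minimal hitting sets -/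

/-- The part of `t` below `i`. -/
def pre (t : Finset ℕ) (i : ℕ) : Finset ℕ := t.filter (· < i)

theorem mem_pre {t : Finset ℕ} {i x : ℕ} : x ∈ pre t i ↔ x ∈ t ∧ x < i := by
  simp [pre]

section MinHit
variable {m : ℕ} {φ : List (List ℕ)}

/-- The private clause of an element of `t` can be met by a subset of `t` only in that element. -/
theorem MinHit.eq_of_subset {s t : Finset ℕ} (ht : MinHit φ t) (hs : Hits φ s) (hst : s ⊆ t) :
    s = t := by
  refine hst.antisymm fun x hx => ?_
  obtain ⟨c, hc, -, h⟩ := ht.2 x hx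
  obtain ⟨y, hy, hys⟩ := hs c hc
  rwa [← h y hy (hst hys)]

theorem exists_minHit_subset {t : Finset ℕ} (ht : Hits φ t) : ∃ s ⊆ t, MinHit φ s := by
  induction t using Finset.strongInduction with
  | H t ih =>
    by_cases hmin : MinHit φ t
    · exact ⟨t, subset_rfl, hmin⟩
    · obtain ⟨x, hx, hcrit⟩ : ∃ x ∈ t, ∀ c ∈ φ, x ∈ c → ∃ y ∈ c, y ∈ t ∧ y ≠ x := by
        by_contra! h
        exact hmin ⟨ht, h⟩
      obtain ⟨s, hs, hm⟩ := ih (t.erase x) (Finset.erase_ssubset hx) (by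
        intro c hc
        obtain ⟨z, hz, hzt⟩ := ht c hc
        by_cases hzx : z = x
        · obtain ⟨y, hy, hyt, hne⟩ := hcrit c hc (hzx ▸ hz)
          exact ⟨y, hy, Finset.mem_erase.2 ⟨hne, hyt⟩⟩
        · exact ⟨z, hz, Finset.mem_erase.2 ⟨hzx, hzt⟩⟩)
      exact ⟨s, hs.trans (Finset.erase_subset _ _), hm⟩

theorem MinHit.lt (hφ : Valid m φ) {t : Finset ℕ} (ht : MinHit φ t) {x : ℕ} (hx : x ∈ t) :
    x < m := by
  obtain ⟨c, hc, hxc, -⟩ := ht.2 x hx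
  exact hφ.lt c hc x hxc

theorem MinHit.lt_of_low {t : Finset ℕ} {i : ℕ} (ht : MinHit (low φ i) t) {x : ℕ} (hx : x ∈ t) :
    x < i := by
  obtain ⟨c, hc, hxc, -⟩ := ht.2 x hx
  exact (mem_low.1 hc).2 x hxc

theorem low_eq_self (hφ : Valid m φ) : low φ m = φ := by
  rw [low, List.filter_eq_self]
  intro c hc
  simpa using hφ.lt c hc

theorem low_zero (hφ : Valid m φ) : low φ 0 = [] := by
  rw [List.eq_nil_iff_forall_not_mem]
  intro c hc
  obtain ⟨hc, h⟩ := mem_low.1 hc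
  obtain ⟨x, hx⟩ := List.exists_mem_of_ne_nil c (hφ.ne_nil c hc)
  exact absurd (h x hx) (Nat.not_lt_zero _)

theorem minHit_low_zero (hφ : Valid m φ) : MinHit (low φ 0) ∅ := by
  rw [low_zero hφ]
  simp [MinHit, Hits]

/-! ### Prefixes and greedy completion -/

theorem mem_low_succ {i : ℕ} {c : List ℕ} :
    c ∈ low φ (i + 1) ↔ c ∈ low φ i ∨ (c ∈ φ ∧ IsTop i c) := by
  simp only [mem_low, IsTop]
  constructor
  · rintro ⟨hc, h⟩
    by_cases hi : i ∈ c
    · exact Or.inr ⟨hc, hi, fun x hx => Nat.lt_succ_iff.1 (h x hx)⟩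
    · refine Or.inl ⟨hc, fun x hx => ?_⟩
      have := h x hx
      have : x ≠ i := by rintro rfl; exact hi hx
      omega
  · rintro (⟨hc, h⟩ | ⟨hc, -, h⟩)
    · exact ⟨hc, fun x hx => (h x hx).trans (Nat.lt_succ_self i)⟩
    · exact ⟨hc, fun x hx => Nat.lt_succ_iff.2 (h x hx)⟩

theorem Hits.pre {t : Finset ℕ} (ht : Hits φ t) (i : ℕ) : Hits (low φ i) (pre t i) := by
  intro c hc
  obtain ⟨hc, h⟩ := mem_low.1 hc
  obtain ⟨x, hx, hxt⟩ := ht c hc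
  exact ⟨x, hx, mem_pre.2 ⟨hxt, h x hx⟩⟩

/-- Old private clauses do not contain `i` and stay private; if `i` is added, the missed clause that
forced it is private to `i`. -/
theorem minHit_greedyStep {t : Finset ℕ} {i : ℕ} (ht : MinHit (low φ i) t) :
    MinHit (low φ (i + 1)) (greedyStep φ t i) := by
  unfold greedyStep
  split_ifs with h
  · refine ⟨fun c hc => ?_, fun x hx => ?_⟩
    · rcases mem_low_succ.1 hc with hc | ⟨-, hc⟩
      · obtain ⟨x, hx, hxt⟩ := ht.1 c hc
        exact ⟨x, hx, Finset.mem_insert_of_mem hxt⟩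
      · exact ⟨i, hc.1, Finset.mem_insert_self _ _⟩
    · rcases Finset.mem_insert.1 hx with rfl | hx
      · obtain ⟨c, hc, htop, hmiss⟩ := h
        refine ⟨c, mem_low_succ.2 (.inr ⟨hc, htop⟩), htop.1, fun y hy hyt => ?_⟩
        exact (Finset.mem_insert.1 hyt).resolve_right (hmiss y hy)
      · obtain ⟨c, hc, hxc, hcrit⟩ := ht.2 x hx
        refine ⟨c, mem_low_succ.2 (.inl hc), hxc, fun y hy hyt => ?_⟩
        rcases Finset.mem_insert.1 hyt with rfl | hyt
        · exact absurd ((mem_low.1 hc).2 y hy) (lt_irrefl _)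
        · exact hcrit y hy hyt
  · refine ⟨fun c hc => ?_, fun x hx => ?_⟩
    · rcases mem_low_succ.1 hc with hc | ⟨hc, htop⟩
      · exact ht.1 c hc
      · by_contra! h'
        exact h ⟨c, hc, htop, h'⟩
    · obtain ⟨c, hc, h'⟩ := ht.2 x hx
      exact ⟨c, mem_low_succ.2 (.inl hc), h'⟩

theorem pre_greedyStep (t : Finset ℕ) {i j : ℕ} (hji : j ≤ i) :
    pre (greedyStep φ t i) j = pre t j := by
  unfold greedyStep
  split_ifs
  · ext x
    simp only [mem_pre, Finset.mem_insert]
    constructor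
    · rintro ⟨rfl | h, hx⟩
      exacts [absurd hx (not_lt.2 hji), ⟨h, hx⟩]
    · exact fun h => ⟨.inr h.1, h.2⟩
  · rfl

theorem greedy_succ (t : Finset ℕ) (j h : ℕ) :
    greedy φ t j (h + 1) = greedy φ (greedyStep φ t j) (j + 1) h := by
  simp [greedy, List.range'_succ]

theorem minHit_greedy {t : Finset ℕ} {j : ℕ} (h : ℕ) (ht : MinHit (low φ j) t) :
    MinHit (low φ (j + h)) (greedy φ t j h) := by
  induction h generalizing t j with
  | zero => exact ht
  | succ h ih =>
    rw [greedy_succ, show j + (h + 1) = j + 1 + h by omega]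
    exact ih (minHit_greedyStep ht)

theorem pre_greedy (t : Finset ℕ) {i j : ℕ} (h : ℕ) (hij : i ≤ j) :
    pre (greedy φ t j h) i = pre t i := by
  induction h generalizing t j with
  | zero => rfl
  | succ h ih =>
    rw [greedy_succ, ih _ (by omega), pre_greedyStep t hij]

theorem pre_eq_self_of_low {t : Finset ℕ} {i : ℕ} (ht : MinHit (low φ i) t) : pre t i = t :=
  Finset.filter_true_of_mem fun _ hx => ht.lt_of_low hx

theorem pre_eq_self (hφ : Valid m φ) {t : Finset ℕ} (ht : MinHit φ t) : pre t m = t :=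
  Finset.filter_true_of_mem fun _ hx => ht.lt hφ hx

theorem minHit_greedy_of_low (hφ : Valid m φ) {t : Finset ℕ} {j : ℕ} (hj : j ≤ m)
    (ht : MinHit (low φ j) t) : MinHit φ (greedy φ t j (m - j)) := by
  have := minHit_greedy (m - j) ht
  rwa [show j + (m - j) = m by omega, low_eq_self hφ] at this

theorem pre_succ_of_mem {t : Finset ℕ} {i : ℕ} (hi : i ∈ t) :
    pre t (i + 1) = insert i (pre t i) := by
  ext x
  simp only [mem_pre, Finset.mem_insert]
  constructor
  · rintro ⟨h, h'⟩
    rcases Nat.lt_succ_iff_lt_or_eq.1 h' with h' | rfl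
    exacts [.inr ⟨h, h'⟩, .inl rfl]
  · rintro (rfl | h)
    exacts [⟨hi, Nat.lt_succ_self _⟩, ⟨h.1, h.2.trans (Nat.lt_succ_self _)⟩]

theorem pre_succ_of_not_mem {t : Finset ℕ} {i : ℕ} (hi : i ∉ t) : pre t (i + 1) = pre t i := by
  ext x
  simp only [mem_pre]
  constructor
  · rintro ⟨h, h'⟩
    have : x ≠ i := by rintro rfl; exact hi h
    exact ⟨h, by omega⟩
  · exact fun h => ⟨h.1, h.2.trans (Nat.lt_succ_self _)⟩

/-- If `i` is forced, `u` must contain it. If `u` contains `i`, the private clause of `i` has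
largest variable `i` and is missed by the earlier part, so `i` is forced. -/
theorem greedyStep_pre {u : Finset ℕ} (hu : Hits φ u) {i : ℕ}
    (h : MinHit (low φ (i + 1)) (pre u (i + 1))) : greedyStep φ (pre u i) i = pre u (i + 1) := by
  unfold greedyStep
  split_ifs with hn
  · obtain ⟨c, hc, htop, hmiss⟩ := hn
    obtain ⟨x, hx, hxu⟩ := hu c hc
    have hxi : x = i := by
      by_contra hne
      exact hmiss x hx (mem_pre.2 ⟨hxu, lt_of_le_of_ne (htop.2 x hx) hne⟩)
    rw [pre_succ_of_mem (hxi ▸ hxu)]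
  · by_cases hi : i ∈ u
    · obtain ⟨c, hc, hic, hcrit⟩ := h.2 i (mem_pre.2 ⟨hi, Nat.lt_succ_self i⟩)
      exfalso
      rcases mem_low_succ.1 hc with hc' | ⟨hc', htop⟩
      · exact absurd ((mem_low.1 hc').2 i hic) (lt_irrefl _)
      · refine hn ⟨c, hc', htop, fun x hx hxu => ?_⟩
        obtain ⟨h₁, h₂⟩ := mem_pre.1 hxu
        exact h₂.ne (hcrit x hx (mem_pre.2 ⟨h₁, by omega⟩))
    · rw [pre_succ_of_not_mem hi]

/-- As long as the prefixes of `u` remain minimal, the greedy completion has no choice but to follow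
`u`. -/
theorem greedy_pre {u : Finset ℕ} (hu : Hits φ u) {j h : ℕ}
    (hpre : ∀ i, j < i → i ≤ j + h → MinHit (low φ i) (pre u i)) :
    greedy φ (pre u j) j h = pre u (j + h) := by
  induction h generalizing j with
  | zero => rfl
  | succ h ih =>
    rw [greedy_succ, greedyStep_pre hu (hpre (j + 1) (by omega) (by omega)),
      ih fun i hi hi' => hpre i (by omega) (by omega), show j + 1 + h = j + (h + 1) by omega]

/-! ### Reducts, successors and predecessors of a minimal hitting set -/

theorem lt_of_mem_reduct {i : ℕ} {t t' : Finset ℕ} {Δ : List (List ℕ)} (hΔ : IsReduct φ i t Δ)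
    (ht' : MinHit Δ t') {x : ℕ} (hx : x ∈ t') : x < i ∧ x ∉ t := by
  obtain ⟨r, hr, hxr, -⟩ := ht'.2 x hx
  obtain ⟨c, -, htop, rfl, hmiss⟩ := (hΔ r).1 hr
  have := List.mem_filter.1 hxr
  exact ⟨lt_of_le_of_ne (htop.2 x this.1) (by simpa using this.2), hmiss x hxr⟩

/-- The term inserted for `t`, `i`, `t'` comes after `t`. -/
theorem lexLt_greedy {i h : ℕ} {t t' : Finset ℕ} {Δ : List (List ℕ)} (hΔ : IsReduct φ i t Δ)
    (hne : Δ ≠ []) (ht' : MinHit Δ t') : LexLt t (greedy φ (pre t i ∪ t') (i + 1) h) := by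
  apply lexLt_of_filter_ssubset (i := i)
  change pre t i ⊂ pre _ i
  rw [pre_greedy _ _ (Nat.le_succ i)]
  have hlt := fun x hx => lt_of_mem_reduct hΔ ht' (x := x) hx
  refine ⟨fun x hx => mem_pre.2 ⟨Finset.mem_union_left _ hx, (mem_pre.1 hx).2⟩, fun hsub => ?_⟩
  -- A clause of the reduct forces an element into `t'`; it lies below `i` and outside `t`, so the
  -- inclusion is proper.
  obtain ⟨r, hr⟩ := List.exists_mem_of_ne_nil Δ hne
  obtain ⟨x, -, hx⟩ := ht'.1 r hr
  exact (hlt x hx).2 (mem_pre.1 (hsub (mem_pre.2 ⟨Finset.mem_union_right _ hx, (hlt x hx).1⟩))).1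

/-- Every minimal hitting set but the first one is inserted for an earlier one. -/
theorem exists_predecessor (hφ : Valid m φ) {u : Finset ℕ} (hu : MinHit φ u)
    (hne : u ≠ greedy φ ∅ 0 m) :
    ∃ t i t', MinHit φ t ∧ LexLt t u ∧ i ∈ t ∧ (∀ Δ, IsReduct φ i t Δ → MinHit Δ t') ∧
      t'.Nonempty ∧ MinHit (low φ (i + 1)) (pre t i ∪ t') ∧
      u = greedy φ (pre t i ∪ t') (i + 1) (m - (i + 1)) := by
  classical
  -- The last level at which the prefix of `u` fails to be minimal. Without such a level the greedy
  -- completion of the empty set would follow `u` to the end.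
  obtain ⟨i, him, hi, hgt⟩ : ∃ i ≤ m, ¬ MinHit (low φ i) (pre u i) ∧
      ∀ j, i < j → j ≤ m → MinHit (low φ j) (pre u j) := by
    have hex : ∃ j ≤ m, ¬ MinHit (low φ j) (pre u j) := by
      by_contra! h
      apply hne
      have := greedy_pre hu.1 (j := 0) (h := m) fun i _ hi => h i (by omega)
      rw [Nat.zero_add, pre_eq_self hφ hu, show pre u 0 = ∅ by simp [pre]] at this
      exact this.symm
    obtain ⟨j, hj, hP⟩ := hex
    refine ⟨Nat.findGreatest (fun j => ¬ MinHit (low φ j) (pre u j)) m, Nat.findGreatest_le m,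
      Nat.findGreatest_spec (P := fun j => ¬ MinHit (low φ j) (pre u j)) hj hP, fun k hk hkm => ?_⟩
    exact not_not.1 (Nat.findGreatest_is_greatest hk hkm)
  have him : i < m := by
    refine lt_of_le_of_ne him ?_
    rintro rfl
    rw [low_eq_self hφ, pre_eq_self hφ hu] at hi
    exact hi hu
  have hv := hgt (i + 1) (Nat.lt_succ_self i) him
  -- If `i` were in `u`, private clauses of smaller elements at level `i + 1` would avoid `i` and
  -- already be available at level `i`, making the prefix there minimal.
  have hiu : i ∉ u := by
    intro hiu
    refine hi ⟨hu.1.pre i, fun x hx => ?_⟩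
    obtain ⟨hxu, hxi⟩ := mem_pre.1 hx
    obtain ⟨c, hc, hxc, hcrit⟩ := hv.2 x (mem_pre.2 ⟨hxu, by omega⟩)
    refine ⟨c, ?_, hxc, fun y hy hyu => ?_⟩
    · refine (mem_low_succ.1 hc).resolve_right fun h => hxi.ne' ?_
      exact hcrit i h.2.1 (mem_pre.2 ⟨hiu, Nat.lt_succ_self i⟩)
    · obtain ⟨h₁, h₂⟩ := mem_pre.1 hyu
      exact hcrit y hy (mem_pre.2 ⟨h₁, by omega⟩)
  obtain ⟨s, hsv, hs⟩ := exists_minHit_subset (hu.1.pre i)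
  have hsne : s ≠ pre u i := by rintro rfl; exact hi hs
  have hgu : greedy φ (pre u (i + 1)) (i + 1) (m - (i + 1)) = u := by
    rw [greedy_pre hu.1 fun j hj hj' => hgt j (by omega) (by omega),
      show i + 1 + (m - (i + 1)) = m by omega, pre_eq_self hφ hu]
  rw [pre_succ_of_not_mem hiu] at hv hgu
  set v := pre u i with hvdef
  -- Otherwise `s` would meet all clauses at level `i + 1`, against the minimality of `v` there. So
  -- `i` enters `t` and is one of the indices treated for it.
  have hstep : greedyStep φ s i = insert i s := by
    unfold greedyStep
    rw [if_pos]
    by_contra! hno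
    refine hsne (hv.eq_of_subset (fun c hc => ?_) hsv)
    rcases mem_low_succ.1 hc with hc | ⟨hc, htop⟩
    · exact hs.1 c hc
    · exact hno c hc htop
  set t := greedy φ s i (m - i) with htdef
  have ht : MinHit φ t := minHit_greedy_of_low hφ him.le hs
  have hti : pre t i = s := by rw [htdef, pre_greedy _ _ le_rfl, pre_eq_self_of_low hs]
  have hit : i ∈ t := by
    have h₁ : pre t (i + 1) = pre (insert i s) (i + 1) := by
      rw [htdef, show m - i = (m - (i + 1)) + 1 by omega, greedy_succ, hstep,
        pre_greedy _ _ le_rfl]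
    have h₂ : i ∈ pre t (i + 1) := by
      rw [h₁, mem_pre]
      exact ⟨Finset.mem_insert_self _ _, Nat.lt_succ_self i⟩
    exact (mem_pre.1 h₂).1
  have hunion : pre t i ∪ (v \ s) = v := by
    rw [hti]
    exact Finset.union_sdiff_of_subset hsv
  refine ⟨t, i, v \ s, ht, ?_, hit, ?_, ?_, by rwa [hunion], by rw [hunion, hgu]⟩
  · apply lexLt_of_filter_ssubset (i := i)
    change pre t i ⊂ v
    rw [hti]
    exact hsv.ssubset_of_ne hsne
  · intro Δ hΔ
    refine ⟨fun r hr => ?_, fun x hx => ?_⟩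
    · obtain ⟨c, hc, htop, rfl, hmiss⟩ := (hΔ r).1 hr
      obtain ⟨x, hx, hxv⟩ := hv.1 c (mem_low_succ.2 (.inr ⟨hc, htop⟩))
      have hxi := (mem_pre.1 hxv).2
      have hxr : x ∈ c.filter (· ≠ i) := List.mem_filter.2 ⟨hx, by simpa using hxi.ne⟩
      refine ⟨x, hxr, Finset.mem_sdiff.2 ⟨hxv, fun hxs => hmiss x hxr ?_⟩⟩
      rw [← hti] at hxs
      exact (mem_pre.1 hxs).1
    · obtain ⟨hxv, hxs⟩ := Finset.mem_sdiff.1 hx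
      obtain ⟨c, hc, hxc, hcrit⟩ := hv.2 x hxv
      have hxi := (mem_pre.1 hxv).2
      -- A private clause of an element of `v \ s` cannot lie below `i`, where `s` would meet it
      -- too. So its largest variable is `i`, and without `i` it belongs to the reduct.
      rcases mem_low_succ.1 hc with hc' | ⟨hc', htop⟩
      · obtain ⟨y, hy, hys⟩ := hs.1 c hc'
        exact absurd (hcrit y hy (hsv hys) ▸ hys) hxs
      · refine ⟨c.filter (· ≠ i), (hΔ _).2 ⟨c, hc', htop, rfl, fun y hy hyt => ?_⟩,
          List.mem_filter.2 ⟨hxc, by simpa using hxi.ne⟩, fun y hy hyt => ?_⟩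
        · obtain ⟨hyc, hyi⟩ := List.mem_filter.1 hy
          have hys : y ∈ s := by
            rw [← hti, mem_pre]
            exact ⟨hyt, lt_of_le_of_ne (htop.2 y hyc) (by simpa using hyi)⟩
          exact hxs (hcrit y hyc (hsv hys) ▸ hys)
        · exact hcrit y (List.mem_filter.1 hy).1 (Finset.mem_sdiff.1 hyt).1
  · rw [Finset.sdiff_nonempty]
    exact fun h => hsne (hsv.antisymm h)

/-! ### Counting minimal hitting sets -/

open Classical in
/-- The set of all minimal hitting sets. -/
noncomputable def minHits (φ : List (List ℕ)) : Finset (Finset ℕ) :=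
  φ.flatten.toFinset.powerset.filter (MinHit φ)

theorem mem_minHits {t : Finset ℕ} : t ∈ minHits φ ↔ MinHit φ t := by
  simp only [minHits, Finset.mem_filter, Finset.mem_powerset, and_iff_right_iff_imp]
  intro ht x hx
  obtain ⟨c, hc, hxc, -⟩ := ht.2 x hx
  exact List.mem_toFinset.2 (List.mem_flatten.2 ⟨c, hc, hxc⟩)

theorem card_minHits_le (hφ : Valid m φ) : (minHits φ).card ≤ 2 ^ m := by
  have h := Finset.card_le_card (s := minHits φ) (t := (Finset.range m).powerset) fun t ht => by
    rw [Finset.mem_powerset]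
    exact fun x hx => Finset.mem_range.2 ((mem_minHits.1 ht).lt hφ hx)
  simpa using h

theorem card_minHits_pos (hφ : Valid m φ) : 0 < (minHits φ).card := by
  refine Finset.card_pos.2 ⟨greedy φ ∅ 0 m, mem_minHits.2 ?_⟩
  exact minHit_greedy_of_low hφ (Nat.zero_le m) (minHit_low_zero hφ)

/-- Fixing variables to 1 does not increase the number of prime implicants. -/
theorem card_minHits_reduct_le {i : ℕ} {t : Finset ℕ} {Δ : List (List ℕ)} (hφ : Valid m φ)
    (ht : MinHit φ t) (hΔ : IsReduct φ i t Δ) : (minHits Δ).card ≤ (minHits φ).card := by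
  classical
  -- Setting the variables of `S` to 1 leaves only clauses that contain `i` and belong to the reduct
  -- without it, because `t` meets every clause. So `S ∪ t'` is a hitting set, and any minimal one
  -- `p` inside it satisfies `p \ S = t'`, as `i` lies in neither `S` nor `t'`.
  let S : Finset ℕ := pre t i ∪ (Finset.range m).filter (i < ·)
  refine Finset.card_le_card_of_surjOn (· \ S) fun t' ht' => ?_
  have ht' : MinHit Δ t' := mem_minHits.1 ht'
  have hlt := fun x hx => lt_of_mem_reduct hΔ ht' (x := x) hx
  have hits : Hits φ (S ∪ t') := by
    intro c hc
    by_cases hbig : ∃ x ∈ c, i < x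
    · obtain ⟨x, hx, hix⟩ := hbig
      exact ⟨x, hx, by simp [S, hix, hφ.lt c hc x hx]⟩
    · push Not at hbig
      by_cases hS : ∃ x ∈ c, x ≠ i ∧ x ∈ t
      · obtain ⟨x, hx, hxi, hxt⟩ := hS
        have := lt_of_le_of_ne (hbig x hx) hxi
        exact ⟨x, hx, by simp [S, mem_pre, hxt, this]⟩
      · push Not at hS
        obtain ⟨x, hx, hxt⟩ := ht.1 c hc
        have hxi : x = i := by
          by_contra h
          exact hS x hx h hxt
        subst hxi
        obtain ⟨y, hy, hyt⟩ := ht'.1 (c.filter (· ≠ x)) ((hΔ _).2 ⟨c, hc, ⟨hx, hbig⟩, rfl,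
          fun y hy => hS y (List.mem_filter.1 hy).1 (by simpa using (List.mem_filter.1 hy).2)⟩)
        exact ⟨y, (List.mem_filter.1 hy).1, Finset.mem_union_right _ hyt⟩
  obtain ⟨p, hp, hpm⟩ := exists_minHit_subset hits
  refine ⟨p, mem_minHits.2 hpm, ?_⟩
  refine ht'.eq_of_subset (fun r hr => ?_) fun x hx => ?_
  · obtain ⟨c, hc, htop, rfl, hmiss⟩ := (hΔ r).1 hr
    obtain ⟨x, hx, hxp⟩ := hpm.1 c hc
    have hxS : x ∉ S ∧ x ≠ i := by
      have h₁ : x ∈ S → x < i := by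
        intro h
        rcases Finset.mem_union.1 h with h | h
        · exact (mem_pre.1 h).2
        · have := (Finset.mem_filter.1 h).2
          have := htop.2 x hx
          omega
      have hxi : x ≠ i := by
        rintro rfl
        rcases Finset.mem_union.1 (hp hxp) with h | h
        · exact lt_irrefl _ (h₁ h)
        · exact lt_irrefl _ (hlt _ h).1
      refine ⟨fun h => ?_, hxi⟩
      have h₂ := h₁ h
      rcases Finset.mem_union.1 h with h | h
      · exact hmiss x (List.mem_filter.2 ⟨hx, by simpa using hxi⟩) (mem_pre.1 h).1
      · have := (Finset.mem_filter.1 h).2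
        omega
    exact ⟨x, List.mem_filter.2 ⟨hx, by simpa using hxS.2⟩, Finset.mem_sdiff.2 ⟨hxp, hxS.1⟩⟩
  · obtain ⟨h₁, h₂⟩ := Finset.mem_sdiff.1 hx
    exact (Finset.mem_union.1 (hp h₁)).resolve_left h₂

theorem valid_reduct {i : ℕ} {t : Finset ℕ} {Δ : List (List ℕ)} (hφ : Valid m φ)
    (hΔ : IsReduct φ i t Δ) (hne : [] ∉ Δ) : Valid i Δ where
  ne_nil c hc h := hne (h ▸ hc)
  nodup r hr := by
    obtain ⟨c, hc, -, rfl, -⟩ := (hΔ r).1 hr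
    exact (hφ.nodup c hc).filter _
  lt r hr x hx := by
    obtain ⟨c, hc, htop, rfl, -⟩ := (hΔ r).1 hr
    have := List.mem_filter.1 hx
    exact lt_of_le_of_ne (htop.2 x this.1) (by simpa using this.2)

/-- Every clause of the reduct has lost the variable `i`; this is what bounds the recursion depth by
the clause length. -/
theorem isKCNF_reduct {i k : ℕ} {t : Finset ℕ} {Δ : List (List ℕ)} (hk : IsKCNF k φ)
    (hΔ : IsReduct φ i t Δ) : IsKCNF (k - 1) Δ := by
  intro r hr
  obtain ⟨c, hc, htop, rfl, -⟩ := (hΔ r).1 hr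
  have h₁ : (c.filter (· ≠ i)).length < c.length :=
    List.length_filter_lt_length_iff_exists.2 ⟨i, htop.1, by simp⟩
  have := hk c hc
  omega

end MinHit

/-! ### The main loop -/

/-- `ρ` lists the minimal hitting sets of `φ`, each once and in increasing order. -/
structure ListsMinHits (φ ρ : List (List ℕ)) : Prop where
  sorted : ∀ t ∈ ρ, t.Pairwise (· < ·)
  nodup : (ρ.map List.toFinset).Nodup
  mem : ∀ u, u ∈ ρ.map List.toFinset ↔ MinHit φ u

theorem ListsMinHits.length {φ ρ : List (List ℕ)} (h : ListsMinHits φ ρ) :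
    ρ.length = (minHits φ).card := by
  have : (ρ.map List.toFinset).toFinset = minHits φ := by
    ext u
    rw [List.mem_toFinset, h.mem, mem_minHits]
  rw [← this, List.toFinset_card_of_nodup h.nodup, List.length_map]

/-- The terms in the queue. -/
def Tree.terms (Q : Tree) : List (Finset ℕ) := (Q.toList 0).map List.toFinset

/-- `u` is inserted into the queue when index `i` of the term `t` is treated. -/
def IsSuccessor (m : ℕ) (φ : List (List ℕ)) (t : Finset ℕ) (i : ℕ) (u : Finset ℕ) : Prop :=
  ∃ t', (∀ Δ, IsReduct φ i t Δ → MinHit Δ t') ∧ t'.Nonempty ∧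
    MinHit (low φ (i + 1)) (pre t i ∪ t') ∧
    u = greedy φ (pre t i ∪ t') (i + 1) (m - (i + 1))

theorem IsReduct.minHit_iff {φ Δ Δ' : List (List ℕ)} {i : ℕ} {t t' : Finset ℕ}
    (h : IsReduct φ i t Δ) (h' : IsReduct φ i t Δ') : MinHit Δ t' ↔ MinHit Δ' t' := by
  have : ∀ r, r ∈ Δ ↔ r ∈ Δ' := fun r => (h r).trans (h' r).symm
  simp only [MinHit, Hits, this]

theorem MinHit.nonempty {φ : List (List ℕ)} {t : Finset ℕ} (ht : MinHit φ t) (hne : φ ≠ []) :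
    t.Nonempty := by
  obtain ⟨c, hc⟩ := List.exists_mem_of_ne_nil φ hne
  obtain ⟨x, -, hx⟩ := ht.1 c hc
  exact ⟨x, hx⟩

/-- A minimal hitting set is nonempty iff there is a clause to meet, so nonemptiness of `t'` encodes
that the reduct is not the constant 1. The quantifier over reducts may be dropped because minimality
depends only on the set of clauses. -/
theorem isSuccessor_iff {m : ℕ} {φ Δ : List (List ℕ)} {i : ℕ} {t u : Finset ℕ}
    (hΔ : IsReduct φ i t Δ) :
    IsSuccessor m φ t i u ↔ Δ ≠ [] ∧ ∃ t', MinHit Δ t' ∧ MinHit (low φ (i + 1)) (pre t i ∪ t') ∧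
      u = greedy φ (pre t i ∪ t') (i + 1) (m - (i + 1)) := by
  constructor
  · rintro ⟨t', h, ⟨x, hx⟩, h'⟩
    obtain ⟨c, hc, -⟩ := (h Δ hΔ).2 x hx
    exact ⟨List.ne_nil_of_mem hc, t', h Δ hΔ, h'⟩
  · rintro ⟨hne, t', h, h'⟩
    exact ⟨t', fun Δ' hΔ' => (hΔ.minHit_iff hΔ').1 h, h.nonempty hne, h'⟩

section MainLoop
variable {m : ℕ} {φ : List (List ℕ)} {B : ℕ → List (List ℕ)}

theorem toFinset_filter_range {A : ℕ → Bool} {t : Finset ℕ} (hA : Rep A t)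
    (ht : ∀ x ∈ t, x < m) : ((List.range' 0 m).filter A).toFinset = t := by
  ext x
  rw [List.mem_toFinset, List.mem_filter, hA x, List.mem_range'_1]
  exact ⟨fun h => h.2, fun h => ⟨⟨Nat.zero_le _, by simpa using ht x h⟩, h⟩⟩

theorem toFinset_filter_lt (t : List ℕ) (i : ℕ) :
    (t.filter (· < i)).toFinset = pre t.toFinset i := by
  ext x
  simp [mem_pre]

theorem within_tryInsert (hφ : Valid m φ) (hB : IsBuckets m φ B) {t t' : List ℕ} {i : ℕ}
    (hi : i < m) (ht : t.Nodup) (htm : ∀ x ∈ t, x < m) (ht' : t'.Nodup) (htm' : ∀ x ∈ t', x < i)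
    {Q : Tree} (hQ : Q.Ok m) :
    ∃ Q', Within (tryInsert m B t i t' Q) Q' (19 * m + 7 * size φ + 4) 0 ∧ Q'.Ok m ∧
      ∀ u, u ∈ Q'.terms ↔ u ∈ Q.terms ∨
        (MinHit (low φ (i + 1)) (pre t.toFinset i ∪ t'.toFinset) ∧
          u = greedy φ (pre t.toFinset i ∪ t'.toFinset) (i + 1) (m - (i + 1))) := by
  have hb := within_before i t
  set s := t.filter (· < i) with hs
  have hst : s.toFinset = pre t.toFinset i := toFinset_filter_lt t i
  have hl₁ : t.length ≤ m := length_le_of_lt ht htm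
  have hl₂ : s.length ≤ t.length := List.length_filter_le _ _
  have hl₃ : t'.length ≤ m := length_le_of_lt ht' fun x hx => (htm' x hx).trans hi
  obtain ⟨A₁, hw₁, hA₁⟩ := within_markAll rep_empty s
  obtain ⟨A₂, hw₂, hA₂⟩ := within_markAll hA₁ t'
  have hA₂' : Rep A₂ (s ++ t').toFinset := by
    rwa [List.toFinset_append, ← Finset.empty_union s.toFinset]
  rw [Finset.empty_union, hst] at hA₂
  obtain ⟨b, hw₃, hbiff⟩ := within_isPrimePrefix hφ hB hA₂' hi
  rw [List.toFinset_append, hst] at hbiff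
  obtain ⟨A₃, hw₄, hA₃⟩ := within_complete (j := i + 1) (h := m - (i + 1)) hφ hB hA₂ (by omega)
  obtain ⟨Q', hw₅, hQ', -, hmem⟩ := Tree.within_insert A₃ (j := 0) hQ
  have hlen : (s ++ t').length = s.length + t'.length := List.length_append
  -- The common cost of everything up to the test, so that the two branches need only be treated
  -- from there on.
  have hwith : ∀ {Q'' : Tree}, Within (if b = true then (do
        let A ← complete B A₂ (i + 1) (m - (i + 1))
        Tree.insert A m 0 Q : Comp Tree) else pure Q) Q'' (5 * m + 3 * size φ + 1) 0 →
      Within (tryInsert m B t i t' Q) Q'' (19 * m + 7 * size φ + 4) 0 := by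
    intro Q'' hrest
    unfold tryInsert
    exact (Within.charge_bind (hb.bind ((within_newArray m false).bind (hw₁.bind (hw₂.bind
      (Within.charge_bind (hw₃.bind hrest))))))).mono (by omega)
  by_cases hprime : b = true
  · refine ⟨Q', hwith ?_, hQ', fun u => ?_⟩
    · rw [if_pos hprime]
      exact (hw₄.bind hw₅).mono (by omega)
    · have hmin := hbiff.1 hprime
      have hG := minHit_greedy_of_low hφ (show i + 1 ≤ m from hi) hmin
      have hlist := toFinset_filter_range hA₃ fun x hx => hG.lt hφ hx
      simp only [Tree.terms, List.mem_map, hmem]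
      constructor
      · rintro ⟨w, hw | rfl, rfl⟩
        exacts [.inl ⟨w, hw, rfl⟩, .inr ⟨hmin, hlist⟩]
      · rintro (⟨w, hw, rfl⟩ | ⟨-, rfl⟩)
        exacts [⟨w, .inl hw, rfl⟩, ⟨_, .inr rfl, hlist⟩]
  · refine ⟨Q, hwith ?_, hQ, fun u => ?_⟩
    · rw [if_neg hprime]
      exact (within_pure Q).mono (Nat.zero_le _)
    · rw [← hbiff]
      simp [hprime]

/-- Recursion level reached from level `l` if the calls below have depth `e`. -/
def levelBelow (l e : ℕ) : ℕ := if e = 0 then 0 else l + e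

theorem levelBelow_max (l e e' : ℕ) :
    levelBelow l (max e e') = max (levelBelow l e) (levelBelow l e') := by
  unfold levelBelow
  split_ifs <;> omega

/-- The bound for a call of Recursive Dualize with `m` variables, formula length `s`, `N` prime
implicants and recursion depth `e + 1`. -/
def costBound (C m N s e : ℕ) : ℕ := C * (m ^ e * N ^ e * (m + s))

/-- `sub` solves all problems with less than `m` variables at level `l + 1`, at the cost claimed
for Recursive Dualize. -/
def SubSpec (C l m : ℕ) (sub : ℕ → List (List ℕ) → Comp (List (List ℕ))) : Prop :=
  ∀ i < m, ∀ Δ, Valid i Δ → Δ ≠ [] → ∃ ρ e,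
    Within (sub i Δ) ρ (costBound C i ρ.length (size Δ) e) (l + (e + 1)) ∧
    ListsMinHits Δ ρ ∧ ρ.length ≤ ρ.length ^ e ∧ ∀ k, IsKCNF k Δ → e + 1 ≤ k

/-- A bound for the recursive call for index `i` and the insertions that follow; `s` is the length
of the formula and `s'` the length of its part with largest variable `i`. -/
def callBound (C m N s : ℕ) (e i s' : ℕ) : ℕ :=
  match e with
  | 0 => 0
  | e + 1 => C * (m ^ e * N ^ e * (i + s')) + N ^ e * (19 * m + 7 * s + 4)

/-- Calls for different indices and rounds reach different depths; by monotonicity all are charged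
at the largest one. -/
theorem callBound_mono {C m N s e e' : ℕ} (hm : 0 < m) (hN : 0 < N) (h : e ≤ e') (i s' : ℕ) :
    callBound C m N s e i s' ≤ callBound C m N s e' i s' := by
  rcases e with _ | e
  · exact Nat.zero_le _
  · obtain ⟨e', rfl⟩ : ∃ k, e' = k + 1 := ⟨e' - 1, by omega⟩
    have h' : e ≤ e' := by omega
    simp only [callBound]
    gcongr

/-- The treatment of one index of an output term. -/
def treatIndex (sub : ℕ → List (List ℕ) → Comp (List (List ℕ))) (m : ℕ) (B : ℕ → List (List ℕ))
    (t : List ℕ) (A : ℕ → Bool) (Q : Tree) (i : ℕ) : Comp Tree := do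
  charge 1
  let D ← readCell B i
  let Δ ← reduct i D A
  if Δ.isEmpty then
    pure Q
  else if ← hasEmptyClause Δ then
    pure Q
  else
    let ρ ← sub i Δ
    ρ.foldlM (fun Q t' => tryInsert m B t i t' Q) Q

theorem within_treatIndex {sub : ℕ → List (List ℕ) → Comp (List (List ℕ))} {C l : ℕ}
    (hsub : SubSpec C l m sub) (hφ : Valid m φ) (hB : IsBuckets m φ B) {t : List ℕ}
    (ht : t.Nodup) (hmin : MinHit φ t.toFinset) {A : ℕ → Bool} (hA : Rep A t.toFinset) {i : ℕ}
    (hi : i ∈ t) {Q : Tree} (hQ : Q.Ok m) :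
    ∃ Q' e, Within (treatIndex sub m B t A Q i) Q'
        (2 + 5 * size (B i) + callBound C m (minHits φ).card (size φ) e i (size (B i)))
        (levelBelow l e) ∧ Q'.Ok m ∧
      (∀ u, u ∈ Q'.terms ↔ u ∈ Q.terms ∨ IsSuccessor m φ t.toFinset i u) ∧
      (e = 0 → Q' = Q) ∧ ∀ k, IsKCNF k φ → e ≤ k - 1 := by
  have htm : ∀ x ∈ t, x < m := fun x hx => hmin.lt hφ (List.mem_toFinset.2 hx)
  have him := htm i hi
  obtain ⟨Δ, hw, hΔ, hsize, hlen⟩ := within_reduct hφ hB i hA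
  have hsucc := fun u => isSuccessor_iff (m := m) (u := u) hΔ
  by_cases hnil : Δ = []
  · refine ⟨Q, 0, ?_, hQ, fun u => ?_, fun _ => rfl, fun k _ => Nat.zero_le _⟩
    · unfold treatIndex
      refine (Within.charge_bind ((within_readCell B i).bind (hw.bind (K' := 0) ?_))).mono
        (by omega)
      rw [if_pos (by simp [hnil])]
      exact within_pure Q
    · rw [hsucc]
      simp [hnil]
  have hempty := within_hasEmptyClause Δ
  by_cases hbot : [] ∈ Δ
  · refine ⟨Q, 0, ?_, hQ, fun u => ?_, fun _ => rfl, fun k _ => Nat.zero_le _⟩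
    · unfold treatIndex
      refine (Within.charge_bind ((within_readCell B i).bind (hw.bind (K' := size (B i)) ?_))).mono
        (by omega)
      rw [if_neg (by simpa using hnil)]
      refine (hempty.bind (K' := 0) ?_).mono (by omega)
      rw [if_pos (by simpa using hbot)]
      exact within_pure Q
    · rw [hsucc]
      have : ∀ t', ¬ MinHit Δ t' := fun t' h => by
        obtain ⟨x, hx, -⟩ := h.1 [] hbot
        simp at hx
      simp [this]
  have hval := valid_reduct hφ hΔ hbot
  obtain ⟨ρ, e, hwρ, hρ, hle, hk⟩ := hsub i him Δ hval hnil
  have hN : ρ.length ≤ (minHits φ).card := by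
    rw [hρ.length]
    exact card_minHits_reduct_le hφ hmin hΔ
  obtain ⟨Q', hwQ, hQ', hmem⟩ := within_foldlM_rel
    (R := fun (Q' : Tree) (S : List (List ℕ)) => Q'.Ok m ∧ ∀ u, u ∈ Q'.terms ↔ u ∈ Q.terms ∨
      ∃ t' ∈ S, MinHit (low φ (i + 1)) (pre t.toFinset i ∪ t'.toFinset) ∧
        u = greedy φ (pre t.toFinset i ∪ t'.toFinset) (i + 1) (m - (i + 1)))
    (f := fun Q t' => tryInsert m B t i t' Q) (g := fun S c => S ++ [c])
    (fun _ => 19 * m + 7 * size φ + 4) ρ Q [] ⟨hQ, by simp⟩ (by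
      rintro t' ht' Q₁ S ⟨hQ₁, hm₁⟩
      have hmin' : MinHit Δ t'.toFinset := (hρ.mem _).1 (List.mem_map.2 ⟨t', ht', rfl⟩)
      obtain ⟨Q₂, hw₂, hQ₂, hm₂⟩ := within_tryInsert hφ hB him ht htm
        (t' := t') ((hρ.sorted t' ht').imp fun h => h.ne)
        (fun x hx => (lt_of_mem_reduct hΔ hmin' (List.mem_toFinset.2 hx)).1) hQ₁
      refine ⟨Q₂, hw₂, hQ₂, fun u => ?_⟩
      rw [hm₂, hm₁, or_assoc]
      refine or_congr_right ?_
      constructor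
      · rintro (⟨c, hc, h⟩ | h)
        exacts [⟨c, by simp [hc], h⟩, ⟨t', by simp, h⟩]
      · rintro ⟨c, hc, h⟩
        rcases List.mem_append.1 hc with hc | hc
        · exact Or.inl ⟨c, hc, h⟩
        · rw [List.mem_singleton.1 hc] at h
          exact Or.inr h)
  rw [foldl_append_singleton, List.nil_append] at hmem
  have hpow : ρ.length ^ e ≤ (minHits φ).card ^ e := Nat.pow_le_pow_left hN e
  refine ⟨Q', e + 1, ?_, hQ', fun u => ?_, fun h => absurd h (Nat.succ_ne_zero e),
    fun k hk' => ?_⟩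
  · unfold treatIndex
    refine (Within.charge_bind ((within_readCell B i).bind (hw.bind (K' := size (B i) +
      callBound C m (minHits φ).card (size φ) (e + 1) i (size (B i))) ?_))).mono (by omega)
    rw [if_neg (by simpa using hnil)]
    have h := hwρ.bind' hwQ
    rw [max_eq_left (Nat.zero_le _)] at h
    unfold levelBelow
    rw [if_neg (Nat.succ_ne_zero e)]
    refine (hempty.bind (K' := callBound C m (minHits φ).card (size φ) (e + 1) i (size (B i)))
      ?_).mono (by omega)
    rw [if_neg (by simpa using hbot)]
    refine h.mono ?_
    rw [List.map_const', List.sum_replicate, smul_eq_mul]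
    simp only [costBound, callBound]
    have := him.le
    -- The number of insertions is the number of terms returned; it is at most its own `e`-th power,
    -- since a call with `e = 0` returns at most one term.
    have := hle.trans hpow
    gcongr
  · rw [hmem, hsucc]
    refine or_congr_right ⟨?_, ?_⟩
    · rintro ⟨t', ht', h⟩
      exact ⟨hnil, t'.toFinset, (hρ.mem _).1 (List.mem_map.2 ⟨t', ht', rfl⟩), h⟩
    · rintro ⟨-, t', ht', h⟩
      obtain ⟨w, hw, rfl⟩ := List.mem_map.1 ((hρ.mem _).2 ht')
      exact ⟨w, hw, h⟩
  · exact hk _ (isKCNF_reduct hk' hΔ)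

theorem within_treatIndices {sub : ℕ → List (List ℕ) → Comp (List (List ℕ))} {C l : ℕ}
    (hsub : SubSpec C l m sub) (hφ : Valid m φ) (hB : IsBuckets m φ B) {t : List ℕ}
    (ht : t.Nodup) (hmin : MinHit φ t.toFinset) {A : ℕ → Bool} (hA : Rep A t.toFinset)
    {I : List ℕ} (hI : ∀ i ∈ I, i ∈ t) {Q : Tree} (hQ : Q.Ok m) :
    ∃ Q' e, Within (I.foldlM (treatIndex sub m B t A) Q) Q'
        (I.map fun i => 2 + 5 * size (B i) +
          callBound C m (minHits φ).card (size φ) e i (size (B i))).sum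
        (levelBelow l e) ∧ Q'.Ok m ∧
      (∀ u, u ∈ Q'.terms ↔ u ∈ Q.terms ∨ ∃ i ∈ I, IsSuccessor m φ t.toFinset i u) ∧
      (e = 0 → Q' = Q) ∧ ∀ k, IsKCNF k φ → e ≤ k - 1 := by
  induction I generalizing Q with
  | nil => exact ⟨Q, 0, within_pure Q, hQ, by simp, fun _ => rfl, fun k _ => Nat.zero_le _⟩
  | cons i I ih =>
    obtain ⟨Q₁, e₁, hw₁, hQ₁, hm₁, he₁, hk₁⟩ :=
      within_treatIndex hsub hφ hB ht hmin hA (hI i (by simp)) hQ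
    obtain ⟨Q₂, e₂, hw₂, hQ₂, hm₂, he₂, hk₂⟩ := ih (fun j hj => hI j (by simp [hj])) hQ₁
    have hm : 0 < m := Nat.zero_lt_of_lt
      (hmin.lt hφ (List.mem_toFinset.2 (hI i (by simp))))
    have hN := card_minHits_pos hφ
    refine ⟨Q₂, max e₁ e₂, ?_, hQ₂, fun u => ?_, fun h => ?_,
      fun k hk => max_le (hk₁ k hk) (hk₂ k hk)⟩
    · rw [levelBelow_max, List.foldlM_cons, List.map_cons, List.sum_cons]
      refine (hw₁.bind' hw₂).mono (Nat.add_le_add (Nat.add_le_add_left ?_ _)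
        (List.sum_le_sum fun j _ => Nat.add_le_add_left ?_ _))
      · exact callBound_mono hm hN (le_max_left _ _) _ _
      · exact callBound_mono hm hN (le_max_right _ _) _ _
    · rw [hm₂, hm₁, or_assoc]
      simp
    · rw [he₂ (by omega), he₁ (by omega)]

/-- The invariant of the main loop. -/
structure LoopInvariant (m : ℕ) (φ : List (List ℕ)) (Q : Tree) (out : List (List ℕ)) : Prop where
  ok : Q.Ok m
  minHit_queue : ∀ u ∈ Q.terms, MinHit φ u
  sorted : ∀ t ∈ out, t.Pairwise (· < ·)
  nodup : (out.map List.toFinset).Nodup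
  minHit_out : ∀ u ∈ out.map List.toFinset, MinHit φ u
  lexLt : ∀ o ∈ out.map List.toFinset, ∀ u ∈ Q.terms, LexLt o u
  closed : ∀ o ∈ out.map List.toFinset, ∀ i ∈ o, ∀ u, IsSuccessor m φ o i u →
    u ∈ Q.terms ∨ u ∈ out.map List.toFinset
  start : greedy φ ∅ 0 m ∈ Q.terms ∨ greedy φ ∅ 0 m ∈ out.map List.toFinset

theorem LoopInvariant.length_le {Q : Tree} {out : List (List ℕ)} (h : LoopInvariant m φ Q out) :
    out.length ≤ (minHits φ).card := by
  rw [← List.length_map (f := List.toFinset) (as := out), ← List.toFinset_card_of_nodup h.nodup]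
  exact Finset.card_le_card fun u hu => mem_minHits.2 (h.minHit_out u (List.mem_toFinset.1 hu))

/-- Once the queue is empty, the start term has been output, and so has every successor of an output
term. As every other solution succeeds a smaller one, induction along the lexicographic order
reaches all of them. -/
theorem LoopInvariant.listsMinHits (hφ : Valid m φ) {out : List (List ℕ)}
    (h : LoopInvariant m φ .nil out) : ListsMinHits φ out where
  sorted := h.sorted
  nodup := h.nodup
  mem u := by
    refine ⟨h.minHit_out u, fun hu => ?_⟩
    have hwf : (minHits φ : Set (Finset ℕ)).WellFoundedOn LexLt :=
      (minHits φ).finite_toSet.wellFoundedOn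
    refine hwf.induction (P := fun u => u ∈ out.map List.toFinset) (mem_minHits.2 hu) ?_
    intro u hu ih
    have hu : MinHit φ u := mem_minHits.1 hu
    by_cases hne : u = greedy φ ∅ 0 m
    · rw [hne]
      exact h.start.resolve_left (by simp [Tree.terms, Tree.toList])
    · obtain ⟨t, i, t', ht, hlt, hit, h₁⟩ := exists_predecessor hφ hu hne
      have hout := ih t (mem_minHits.2 ht) hlt
      exact (h.closed t hout i hit u ⟨t', h₁⟩).resolve_left (by simp [Tree.terms, Tree.toList])

theorem IsSuccessor.minHit (hφ : Valid m φ) {t u : Finset ℕ} {i : ℕ} (hi : i < m)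
    (h : IsSuccessor m φ t i u) : MinHit φ u := by
  obtain ⟨t', -, -, h, rfl⟩ := h
  exact minHit_greedy_of_low hφ hi h

/-- The removed term is the smallest in the queue and the inserted ones exceed it, so all outputs
stay below the whole queue. This excludes repeated outputs. -/
theorem LoopInvariant.step (hφ : Valid m φ) {Q Q₁ Q₂ : Tree} {t : List ℕ}
    {rest out : List (List ℕ)}
    (h : LoopInvariant m φ Q out) (hQ : Q.toList 0 = t :: rest) (hQ₁ : Q₁.toList 0 = rest)
    (hok : Q₂.Ok m) (hex : ∀ i, ∃ Δ, IsReduct φ i t.toFinset Δ)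
    (hmem : ∀ u, u ∈ Q₂.terms ↔ u ∈ Q₁.terms ∨ ∃ i ∈ t, IsSuccessor m φ t.toFinset i u) :
    LoopInvariant m φ Q₂ (t :: out) := by
  have hterms : ∀ u, u ∈ Q.terms ↔ u = t.toFinset ∨ u ∈ Q₁.terms := by
    intro u
    simp only [Tree.terms, hQ, hQ₁, List.map_cons, List.mem_cons]
  have htQ : t.toFinset ∈ Q.terms := (hterms _).2 (.inl rfl)
  have ht := h.minHit_queue _ htQ
  have hgt : ∀ u ∈ Q₂.terms, LexLt t.toFinset u := by
    intro u hu
    rcases (hmem u).1 hu with hu | ⟨i, -, hu⟩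
    · have hp := Tree.pairwise_toList (j := 0) h.ok
      rw [hQ, List.pairwise_cons] at hp
      obtain ⟨w, hw, rfl⟩ := List.mem_map.1 hu
      exact hp.1 w (hQ₁ ▸ hw)
    · obtain ⟨Δ, hΔ⟩ := hex i
      obtain ⟨hne, t', ht', -, rfl⟩ := (isSuccessor_iff hΔ).1 hu
      exact lexLt_greedy hΔ hne ht'
  refine ⟨hok, fun u hu => ?_, ?_, ?_, ?_, ?_, ?_, ?_⟩
  · rcases (hmem u).1 hu with hu | ⟨i, hi, hu⟩
    · exact h.minHit_queue u ((hterms u).2 (.inr hu))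
    · exact hu.minHit hφ (ht.lt hφ (List.mem_toFinset.2 hi))
  · refine List.forall_mem_cons.2 ⟨?_, h.sorted⟩
    exact (Tree.mem_toList_bounds (j := 0) h.ok (by simp [hQ])).1
  · refine List.nodup_cons.2 ⟨fun hm => ?_, h.nodup⟩
    exact irrefl_of LexLt _ (h.lexLt _ hm _ htQ)
  · exact List.forall_mem_cons.2 ⟨ht, h.minHit_out⟩
  · refine List.forall_mem_cons.2 ⟨hgt, fun o ho u hu => ?_⟩
    exact trans_of LexLt (h.lexLt o ho _ htQ) (hgt u hu)
  · refine List.forall_mem_cons.2 ⟨fun i hi u hu => ?_, fun o ho i hi u hu => ?_⟩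
    · exact Or.inl ((hmem u).2 (.inr ⟨i, List.mem_toFinset.1 hi, hu⟩))
    · rw [List.map_cons, List.mem_cons]
      rcases h.closed o ho i hi u hu with hu | hu
      · rcases (hterms u).1 hu with hu | hu
        exacts [.inr (.inl hu), .inl ((hmem u).2 (.inl hu))]
      · exact .inr (.inr hu)
  · rw [List.map_cons, List.mem_cons]
    rcases h.start with hu | hu
    · rcases (hterms _).1 hu with hu | hu
      exacts [.inr (.inl hu), .inl ((hmem _).2 (.inl hu))]
    · exact .inr (.inr hu)

/-- A bound for one round of the main loop. -/
def roundBound (C m N s : ℕ) (S : ℕ → ℕ) (e : ℕ) : ℕ :=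
  3 + 7 * m + 5 * s + ∑ i ∈ Finset.range m, callBound C m N s e i (S i)

/-- Each round outputs a new minimal hitting set, which bounds the number of rounds; the final `2`
pays for finding the queue empty. If `e = 0`, no call was made and nothing was inserted, so only the
terms already queued are added to the output. -/
theorem within_mainLoop {sub : ℕ → List (List ℕ) → Comp (List (List ℕ))} {C l : ℕ} (hm : 0 < m)
    (hsub : SubSpec C l m sub) (hφ : Valid m φ) (hB : IsBuckets m φ B) {fuel : ℕ} {Q : Tree}
    {out : List (List ℕ)} (h : LoopInvariant m φ Q out)
    (hfuel : (minHits φ).card < fuel + out.length) :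
    ∃ ψ e, Within (mainLoop sub m B fuel Q out) ψ
        (((minHits φ).card - out.length) *
          roundBound C m (minHits φ).card (size φ) (fun i => size (B i)) e + 2)
        (levelBelow l e) ∧
      ListsMinHits φ ψ ∧ (e = 0 → ψ.length = out.length + Q.terms.length) ∧
      ∀ k, IsKCNF k φ → e ≤ k - 1 := by
  induction fuel generalizing Q out with
  | zero =>
    have := h.length_le
    omega
  | succ fuel ih =>
    cases hQ : Q.toList 0 with
    | nil =>
      have hnil : Q = .nil := by
        by_contra hne
        exact Tree.toList_ne_nil h.ok hne hQ
      subst hnil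
      refine ⟨out, 0, ?_, h.listsMinHits hφ, by simp [Tree.terms, Tree.toList],
        fun k _ => Nat.zero_le _⟩
      unfold mainLoop
      refine (Within.charge_bind ((Tree.within_popMin_nil 0).bind (K' := 0) ?_)).mono (by omega)
      exact within_pure out
    | cons t rest =>
      obtain ⟨Q₁, hw₁, hQ₁, hl₁⟩ := Tree.within_popMin h.ok hQ
      have htQ : t.toFinset ∈ Q.terms := by simp [Tree.terms, hQ]
      have ht := h.minHit_queue _ htQ
      have hsorted := (Tree.mem_toList_bounds (j := 0) h.ok (t := t) (by simp [hQ])).1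
      have hnodup : t.Nodup := hsorted.imp fun h => h.ne
      have htm : ∀ x ∈ t, x < m := fun x hx => ht.lt hφ (List.mem_toFinset.2 hx)
      obtain ⟨A, hwA, hA⟩ := within_markAll rep_empty t
      rw [Finset.empty_union] at hA
      obtain ⟨Q₂, e₂, hw₂, hQ₂, hm₂, he₂, hk₂⟩ :=
        within_treatIndices hsub hφ hB hnodup ht hA (fun i hi => hi) hQ₁
      have hinv := h.step hφ hQ hl₁ hQ₂
        (fun i => (within_reduct hφ hB i hA).imp fun Δ hΔ => hΔ.2.1) hm₂
      have hlen := hinv.length_le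
      rw [List.length_cons] at hlen
      obtain ⟨ψ, e₃, hw₃, hψ, he₃, hk₃⟩ := ih hinv (by rw [List.length_cons]; omega)
      have hN := card_minHits_pos hφ
      refine ⟨ψ, max e₂ e₃, ?_, hψ, fun he => ?_, fun k hk => max_le (hk₂ k hk) (hk₃ k hk)⟩
      · have hround : ∀ e ≤ max e₂ e₃,
            ∑ i ∈ Finset.range m, callBound C m (minHits φ).card (size φ) e i (size (B i)) ≤
            ∑ i ∈ Finset.range m,
              callBound C m (minHits φ).card (size φ) (max e₂ e₃) i (size (B i)) :=
          fun e he => Finset.sum_le_sum fun i _ => callBound_mono hm hN he _ _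
        have hb₂ := sum_map_le_sum_range (m := m) (fun i => 2 + 5 * size (B i) +
          callBound C m (minHits φ).card (size φ) e₂ i (size (B i))) hnodup htm
        rw [Finset.sum_add_distrib, Finset.sum_add_distrib, ← Finset.mul_sum, hB.sum,
          Finset.sum_const, Finset.card_range, smul_eq_mul] at hb₂
        have h₂ := hround e₂ (le_max_left _ _)
        have h₃ := hround e₃ (le_max_right _ _)
        have hl := length_le_of_lt hnodup htm
        rw [levelBelow_max]
        unfold mainLoop
        refine Within.mono (Within.charge_bind (hw₁.bind ((within_newArray m false).bind
          (hwA.bind (hw₂.bind' hw₃))))) ?_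
        rw [List.length_cons, show (minHits φ).card - out.length =
          ((minHits φ).card - (out.length + 1)) + 1 by omega, Nat.add_mul, one_mul]
        have hmul : ((minHits φ).card - (out.length + 1)) *
            roundBound C m (minHits φ).card (size φ) (fun i => size (B i)) e₃ ≤
            ((minHits φ).card - (out.length + 1)) *
            roundBound C m (minHits φ).card (size φ) (fun i => size (B i)) (max e₂ e₃) :=
          Nat.mul_le_mul_left _ (Nat.add_le_add_left h₃ _)
        have hr : roundBound C m (minHits φ).card (size φ) (fun i => size (B i)) (max e₂ e₃) =
          3 + 7 * m + 5 * size φ + ∑ i ∈ Finset.range m,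
              callBound C m (minHits φ).card (size φ) (max e₂ e₃) i (size (B i)) := rfl
        omega
      · rw [he₃ (by omega), he₂ (by omega)]
        simp only [Tree.terms, hQ, hl₁, List.length_map, List.length_cons]
        omega

end MainLoop

/-! ### Recursive Dualize -/

/-- The gain of a factor 2 that keeps the constant of the recursion from growing with the depth; it
fails for `m = 1`. -/
theorem two_mul_sum_range_le {m : ℕ} (hm : 2 ≤ m) (S : ℕ → ℕ) :
    2 * ∑ i ∈ Finset.range m, (i + S i) ≤ m * (m + ∑ i ∈ Finset.range m, S i) := by
  have h₁ := Finset.sum_range_id_mul_two m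
  rw [Finset.sum_add_distrib, mul_add, mul_comm 2, h₁, mul_add]
  exact Nat.add_le_add (Nat.mul_le_mul_left _ (Nat.sub_le _ _)) (Nat.mul_le_mul_right _ hm)

/-- The recursion for the costs is solved by `costBound 100`; formulas of one variable make no
recursive calls. -/
theorem cost_recursion {m N e : ℕ} (hm : 0 < m) (hN : 0 < N) (hN0 : e = 0 → N ≤ 1) (S : ℕ → ℕ)
    {s : ℕ} (hs : ∑ i ∈ Finset.range m, S i = s) {C : ℕ} (hC : C ≤ 100) (hC1 : m = 1 → C = 0) :
    7 * m + 7 * s + 7 + (N * roundBound C m N s S e + 2) ≤ costBound 100 m N s e := by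
  unfold costBound roundBound
  rcases e with _ | e
  · have : N = 1 := le_antisymm (hN0 rfl) hN
    subst this
    simp only [callBound, Finset.sum_const_zero, pow_zero]
    omega
  · simp only [callBound]
    rw [Finset.sum_add_distrib, Finset.sum_const, Finset.card_range, smul_eq_mul, ← Finset.mul_sum,
      ← Finset.mul_sum]
    set X := m ^ (e + 1) * N ^ (e + 1) * (m + s) with hX
    have hm1 : 1 ≤ m ^ e := Nat.one_le_pow _ _ hm
    have hN1 : 1 ≤ N ^ e := Nat.one_le_pow _ _ hN
    have hmm : 1 ≤ m ^ (e + 1) := Nat.one_le_pow _ _ hm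
    have hNN : 1 ≤ N ^ (e + 1) := Nat.one_le_pow _ _ hN
    have h₁ : m + s ≤ X := by
      rw [hX]
      exact Nat.le_mul_of_pos_left _ (Nat.mul_pos hmm hNN)
    have h₂ : N * (m + s) ≤ X := by
      calc N * (m + s) ≤ N ^ (e + 1) * (m + s) := by
            gcongr
            exact Nat.le_self_pow (Nat.succ_ne_zero e) N
        _ ≤ m ^ (e + 1) * (N ^ (e + 1) * (m + s)) := Nat.le_mul_of_pos_left _ hmm
        _ = X := by rw [hX, mul_assoc]
    have h₃ : N * (m * (N ^ e * (m + s))) ≤ X := by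
      calc N * (m * (N ^ e * (m + s))) = m * (N ^ (e + 1) * (m + s)) := by ring
        _ ≤ m ^ (e + 1) * (N ^ (e + 1) * (m + s)) := by
            gcongr
            exact Nat.le_self_pow (Nat.succ_ne_zero e) m
        _ = X := by rw [hX, mul_assoc]
    have h₄ : 2 * (N * (C * (m ^ e * N ^ e * ∑ i ∈ Finset.range m, (i + S i)))) ≤ 100 * X := by
      rcases Nat.eq_or_lt_of_le (Nat.succ_le_of_lt hm) with h | h
      · rw [hC1 h.symm]
        simp
      · calc 2 * (N * (C * (m ^ e * N ^ e * ∑ i ∈ Finset.range m, (i + S i))))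
            = C * (m ^ e * N ^ (e + 1) * (2 * ∑ i ∈ Finset.range m, (i + S i))) := by ring
          _ ≤ 100 * (m ^ e * N ^ (e + 1) * (m * (m + ∑ i ∈ Finset.range m, S i))) := by
              exact Nat.mul_le_mul hC (Nat.mul_le_mul_left _ (two_mul_sum_range_le h S))
          _ = 100 * X := by rw [hs, hX]; ring
    have h₅ : N * (m * (N ^ e * (19 * m + 7 * s + 4))) ≤ 23 * X := by
      calc N * (m * (N ^ e * (19 * m + 7 * s + 4))) ≤ N * (m * (N ^ e * (23 * (m + s)))) := by
            gcongr
            omega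
        _ = 23 * (N * (m * (N ^ e * (m + s)))) := by ring
        _ ≤ 23 * X := by gcongr
    have h₆ : N * (3 + 7 * m + 5 * s) ≤ 10 * X := by
      calc N * (3 + 7 * m + 5 * s) ≤ N * (10 * (m + s)) := by
            gcongr
            omega
        _ = 10 * (N * (m + s)) := by ring
        _ ≤ 10 * X := by gcongr
    rw [mul_add N (3 + 7 * m + 5 * s), mul_add N (C * _)]
    have h₇ : 7 * m + 7 * s + 9 ≤ 16 * X := by
      have : 1 ≤ X := le_trans (by omega) h₁
      omega
    -- In units of `X` the parts are 50 for the calls, 23 for the insertions, 10 for the rounds and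
    -- 16 for the initialization: 99 in all.
    omega

/-- Strong induction on the number of variables, since calls are on fewer. The fuel covers at most
`2 ^ m` rounds, the final empty test and the entry; what is left after entry suffices for each call
because `2 ^ i < 2 ^ m`. The inequality between `ρ.length` and its power has content only for `e =
0`, where it says that there is at most one output. -/
theorem within_rDualize {m : ℕ} {φ : List (List ℕ)} (hφ : Valid m φ) (hne : φ ≠ []) {fuel : ℕ}
    (hfuel : 2 ^ m + 2 ≤ fuel) (l : ℕ) :
    ∃ ρ e, Within (rDualize fuel l m φ) ρ (costBound 100 m ρ.length (size φ) e) (l + e) ∧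
      ListsMinHits φ ρ ∧ ρ.length ≤ ρ.length ^ e ∧ ∀ k, IsKCNF k φ → e + 1 ≤ k := by
  induction m using Nat.strong_induction_on generalizing φ fuel l with
  | _ m ih =>
  obtain ⟨c₀, hc₀⟩ := List.exists_mem_of_ne_nil φ hne
  obtain ⟨x₀, hx₀⟩ := List.exists_mem_of_ne_nil c₀ (hφ.ne_nil c₀ hc₀)
  have hm : 0 < m := Nat.zero_lt_of_lt (hφ.lt c₀ hc₀ x₀ hx₀)
  obtain ⟨fuel, rfl⟩ : ∃ k, fuel = k + 1 := ⟨fuel - 1, by have := Nat.two_pow_pos m; omega⟩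
  -- For `m = 1` a call would need a nonempty clause over no variables, so the specification of
  -- `sub` holds vacuously even with `C = 0`. This replaces the factor 2 missing in that case.
  obtain ⟨C, hC, hC1, hsub⟩ : ∃ C ≤ 100, (m = 1 → C = 0) ∧
      SubSpec C l m (rDualize fuel (l + 1)) := by
    by_cases h1 : m = 1
    · refine ⟨0, by omega, fun _ => rfl, fun i hi Δ hΔ hne => ?_⟩
      obtain ⟨c, hc⟩ := List.exists_mem_of_ne_nil Δ hne
      obtain ⟨x, hx⟩ := List.exists_mem_of_ne_nil c (hΔ.ne_nil c hc)
      have := hΔ.lt c hc x hx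
      omega
    · refine ⟨100, le_rfl, fun h => absurd h h1, fun i hi Δ hΔ hne => ?_⟩
      have hpow : 2 ^ i < 2 ^ m := Nat.pow_lt_pow_right (by omega) hi
      obtain ⟨ρ, e, h⟩ := ih i hi hΔ hne (fuel := fuel) (by omega) (l + 1)
      rw [show l + 1 + e = l + (e + 1) by omega] at h
      exact ⟨ρ, e, h⟩
  obtain ⟨B, hw₁, hB⟩ := within_buckets hφ
  obtain ⟨A, hw₂, hA⟩ := within_complete (j := 0) (h := m) hφ hB rep_empty (by omega)
  obtain ⟨Q, hw₃, hQ, -, hmem⟩ := Tree.within_insert A (h := m) (j := 0) (T := .nil)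
    (by simp [Tree.Ok])
  have hmin : MinHit φ (greedy φ ∅ 0 m) :=
    minHit_greedy_of_low hφ (Nat.zero_le m) (minHit_low_zero hφ)
  have hset := toFinset_filter_range hA fun x hx => hmin.lt hφ hx
  have hlist : Q.toList 0 = [(List.range' 0 m).filter A] := by
    have hp := Tree.pairwise_toList (j := 0) hQ
    have hmem' : ∀ t, t ∈ Q.toList 0 ↔ t = (List.range' 0 m).filter A := by
      simpa [Tree.toList] using hmem
    refine List.perm_singleton.1 ((List.perm_ext_iff_of_nodup ?_ (by simp)).2 fun t => ?_)
    · refine List.Pairwise.imp ?_ hp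
      rintro a _ h rfl
      exact irrefl_of LexLt _ h
    · rw [hmem', List.mem_singleton]
  have hterms : Q.terms = [greedy φ ∅ 0 m] := by
    rw [Tree.terms, hlist, List.map_singleton, hset]
  have hinv : LoopInvariant m φ Q [] := by
    refine ⟨hQ, ?_, by simp, by simp, by simp, by simp, by simp, ?_⟩
    · rw [hterms]
      simpa using hmin
    · simp [hterms]
  have hcard := card_minHits_le hφ
  obtain ⟨ψ, e, hw₄, hψ, he, hk⟩ := within_mainLoop hm hsub hφ hB hinv (fuel := fuel)
    (by simp; omega)
  have hlen := hψ.length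
  have hpos : 0 < ψ.length := hlen ▸ card_minHits_pos hφ
  have hN0 : e = 0 → ψ.length ≤ 1 := fun h => by simp [he h, hterms]
  have hcost := cost_recursion hm hpos hN0 (fun i => size (B i)) hB.sum hC hC1
  refine ⟨ψ, e, ?_, hψ, ?_, fun k hk' => ?_⟩
  · have hlevel : max l (levelBelow l e) = l + e := by
      unfold levelBelow
      split_ifs <;> omega
    unfold rDualize
    rw [← hlevel]
    refine Within.mono ((within_enter l).bind' (Within.charge_bind (hw₁.bind
      ((within_newArray m false).bind (hw₂.bind (hw₃.bind hw₄)))))) ?_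
    refine le_trans ?_ hcost
    rw [← hlen]
    simp only [List.length_nil, Nat.sub_zero]
    omega
  · rcases Nat.eq_zero_or_pos e with h | h
    · rw [h, pow_zero]
      exact hN0 h
    · exact Nat.le_self_pow h.ne' _
  · have h₁ := hk k hk'
    have h₂ := hk' c₀ hc₀
    have h₃ := List.length_pos_of_mem hx₀
    omega

/-! ### Prime implicants and minimal hitting sets -/

section Prime
variable {n : ℕ}

theorem boolFn_le_iff {f g : BoolFn n} : f ≤ g ↔ ∀ v, f v = true → g v = true := by
  rw [Pi.le_def]
  exact forall_congr' fun v => Bool.le_iff_imp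

theorem termFn_eq_true {t : Finset (Lit n)} {v : Fin n → Bool} :
    termFn t v = true ↔ ∀ p ∈ t, v p.1 = p.2 := by
  simp [termFn]

theorem clauseFn_eq_true {t : Finset (Lit n)} {v : Fin n → Bool} :
    clauseFn t v = true ↔ ∃ p ∈ t, v p.1 = p.2 := by
  simp [clauseFn]

theorem termFn_le_of_subset {s t : Finset (Lit n)} (h : t ⊆ s) : termFn s ≤ termFn t := by
  rw [boolFn_le_iff]
  intro v hv
  rw [termFn_eq_true] at hv ⊢
  exact fun p hp => hv p (h hp)

/-- If a literal of `t` is not in `s`, some assignment satisfies all of `s` and falsifies that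
literal; consistency of `s` makes it well defined. -/
theorem subset_of_termFn_le {s t : Finset (Lit n)} (hs : Consistent s)
    (h : termFn s ≤ termFn t) : t ⊆ s := by
  intro p hp
  by_contra hps
  have h₁ := boolFn_le_iff.1 h (fun i => if i = p.1 then !p.2 else decide ((i, true) ∈ s))
  rw [termFn_eq_true, termFn_eq_true] at h₁
  have h₂ := h₁ (fun q hq => ?_) p hp
  · simp at h₂
  · obtain ⟨i, b⟩ := q
    by_cases hi : i = p.1
    · subst hi
      have : b ≠ p.2 := by rintro rfl; exact hps hq
      simp only [if_true]
      cases b <;> cases hp2 : p.2 <;> simp_all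
    · simp only [if_neg hi]
      cases b with
      | true => simpa using hq
      | false => simpa using fun h => hs i ⟨h, hq⟩

/-- The positive literals of the variables in `u`. -/
def posOf (n : ℕ) (u : Finset ℕ) : Finset (Lit n) :=
  Finset.univ.filter fun p => p.2 = true ∧ (p.1 : ℕ) ∈ u

/-- The variables that occur as positive literals. -/
def positives (t : Finset (Lit n)) : Finset ℕ :=
  (t.filter fun p => p.2 = true).image fun p => (p.1 : ℕ)

theorem posLits_eq_posOf (l : List ℕ) : posLits n l = posOf n l.toFinset := by
  simp [posLits, posOf]

theorem mem_posOf {u : Finset ℕ} {p : Lit n} : p ∈ posOf n u ↔ p.2 = true ∧ (p.1 : ℕ) ∈ u := by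
  simp [posOf]

theorem mem_positives {t : Finset (Lit n)} {x : ℕ} :
    x ∈ positives t ↔ ∃ h : x < n, ((⟨x, h⟩, true) : Lit n) ∈ t := by
  simp only [positives, Finset.mem_image, Finset.mem_filter]
  constructor
  · rintro ⟨⟨i, b⟩, ⟨hp, rfl⟩, rfl⟩
    exact ⟨i.2, hp⟩
  · rintro ⟨h, hp⟩
    exact ⟨_, ⟨hp, rfl⟩, rfl⟩

theorem consistent_posOf (u : Finset ℕ) : Consistent (posOf n u) := by
  rintro i ⟨-, h⟩
  simp [mem_posOf] at h

theorem positives_posOf {u : Finset ℕ} (hu : ∀ x ∈ u, x < n) : positives (posOf n u) = u := by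
  ext x
  rw [mem_positives]
  simp only [mem_posOf, true_and]
  exact ⟨fun h => h.2, fun h => ⟨hu x h, h⟩⟩

theorem posOf_positives_subset (t : Finset (Lit n)) : posOf n (positives t) ⊆ t := by
  rintro ⟨i, b⟩ hp
  obtain ⟨rfl, h⟩ := mem_posOf.1 hp
  exact (mem_positives.1 h).2

theorem posOf_mono {u u' : Finset ℕ} (h : u ⊆ u') : posOf n u ⊆ posOf n u' := fun _ hp =>
  mem_posOf.2 ⟨(mem_posOf.1 hp).1, h (mem_posOf.1 hp).2⟩

theorem cnfFn_eq_true {φ : List (List ℕ)} {v : Fin n → Bool} :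
    cnfFn n φ v = true ↔ ∀ c ∈ φ, ∃ i : Fin n, (i : ℕ) ∈ c ∧ v i = true := by
  simp only [cnfFn, decide_eq_true_eq, clauseFn_eq_true, posLits_eq_posOf, mem_posOf,
    List.mem_toFinset]
  refine forall₂_congr fun c _ => ⟨?_, ?_⟩
  · rintro ⟨⟨i, b⟩, ⟨rfl, h⟩, h'⟩
    exact ⟨i, h, h'⟩
  · rintro ⟨i, h, h'⟩
    exact ⟨(i, true), ⟨rfl, h⟩, h'⟩

theorem termFn_le_cnfFn_iff {φ : List (List ℕ)} {t : Finset (Lit n)} (ht : Consistent t) :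
    termFn t ≤ cnfFn n φ ↔ Hits φ (positives t) := by
  rw [boolFn_le_iff]
  constructor
  · intro h c hc
    have h₁ := h (fun i => decide ((i, true) ∈ t)) (termFn_eq_true.2 ?_)
    · obtain ⟨i, hi, hit⟩ := cnfFn_eq_true.1 h₁ c hc
      exact ⟨i, hi, mem_positives.2 ⟨i.2, by simpa using hit⟩⟩
    · rintro ⟨i, b⟩ hp
      cases b with
      | true => simpa using hp
      | false => simpa using fun h => ht i ⟨h, hp⟩
  · intro h v hv
    rw [cnfFn_eq_true]
    intro c hc
    obtain ⟨x, hx, hxt⟩ := h c hc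
    obtain ⟨hxn, hxt⟩ := mem_positives.1 hxt
    exact ⟨⟨x, hxn⟩, hx, termFn_eq_true.1 hv _ hxt⟩

/-- Only the positive literals of an implicant help to satisfy a positive CNF, so a prime one has no
others. Larger terms are smaller functions, which makes maximal implicants correspond to minimal
hitting sets. -/
theorem isPrimeImplicant_cnfFn_iff {φ : List (List ℕ)} (hφ : Valid n φ) {t : Finset (Lit n)} :
    IsPrimeImplicant (cnfFn n φ) t ↔ ∃ u, MinHit φ u ∧ t = posOf n u := by
  constructor
  · rintro ⟨hc, hle, hprime⟩
    obtain ⟨u, hu, hmin⟩ := exists_minHit_subset ((termFn_le_cnfFn_iff hc).1 hle)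
    have hlt : ∀ x ∈ u, x < n := fun x hx => hmin.lt hφ hx
    have hsub : posOf n u ⊆ t := (posOf_mono hu).trans (posOf_positives_subset t)
    refine ⟨u, hmin, (subset_of_termFn_le (consistent_posOf u) ?_).antisymm hsub⟩
    by_contra hnot
    refine hprime _ (consistent_posOf u) ?_ (lt_of_le_not_ge (termFn_le_of_subset hsub) hnot)
    rw [termFn_le_cnfFn_iff (consistent_posOf u), positives_posOf hlt]
    exact hmin.1
  · rintro ⟨u, hmin, rfl⟩
    have hlt : ∀ x ∈ u, x < n := fun x hx => hmin.lt hφ hx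
    refine ⟨consistent_posOf u, ?_, fun t' hc hle hlt' => ?_⟩
    · rw [termFn_le_cnfFn_iff (consistent_posOf u), positives_posOf hlt]
      exact hmin.1
    · have hsub := subset_of_termFn_le (consistent_posOf u) hlt'.le
      have hpos : positives t' ⊆ u := fun x hx => by
        obtain ⟨hxn, hx⟩ := mem_positives.1 hx
        exact (mem_posOf.1 (hsub hx)).2
      have heq := hmin.eq_of_subset ((termFn_le_cnfFn_iff hc).1 hle) hpos
      exact hlt'.not_ge (termFn_le_of_subset (heq ▸ posOf_positives_subset t'))

theorem clauseFn_eq_dual (c : Finset (Lit n)) : clauseFn c = dual (termFn c) := by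
  funext v
  rw [Bool.eq_iff_iff, clauseFn_eq_true, dual, Bool.not_eq_true', ← Bool.not_eq_true,
    termFn_eq_true]
  push Not
  refine exists_congr fun p => and_congr_right fun _ => ?_
  cases v p.1 <;> cases p.2 <;> simp

theorem dual_le_dual_iff {f g : BoolFn n} : dual f ≤ dual g ↔ g ≤ f := by
  rw [boolFn_le_iff, boolFn_le_iff]
  have h : ∀ (f : BoolFn n) v, dual f v = true ↔ ¬ f (fun i => !(v i)) = true := by
    intro f v
    rw [dual, Bool.not_eq_true', Bool.not_eq_true]
  simp only [h, not_imp_not]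
  refine ⟨fun hfg v hv => ?_, fun hfg v hv => hfg _ hv⟩
  have := hfg (fun i => !(v i))
  simp only [Bool.not_not] at this
  exact this hv

/-- Dualization reverses the pointwise order and turns the conjunction of a literal set into its
disjunction, so the two definitions become the same. -/
theorem isPrimeImplicate_dual_iff {f : BoolFn n} {c : Finset (Lit n)} :
    IsPrimeImplicate (dual f) c ↔ IsPrimeImplicant f c := by
  simp only [IsPrimeImplicate, IsPrimeImplicant, clauseFn_eq_dual, dual_le_dual_iff,
    lt_iff_le_not_ge]

theorem mem_primeImplicants {f : BoolFn n} {t : Finset (Lit n)} :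
    t ∈ primeImplicants f ↔ IsPrimeImplicant f t := by
  simp [primeImplicants]

theorem ListsMinHits.mem_map_posLits {φ ψ : List (List ℕ)} (hφ : Valid n φ)
    (h : ListsMinHits φ ψ) (t : Finset (Lit n)) :
    t ∈ ψ.map (posLits n) ↔ IsPrimeImplicant (cnfFn n φ) t := by
  rw [isPrimeImplicant_cnfFn_iff hφ]
  simp only [← h.mem, List.mem_map, posLits_eq_posOf]
  constructor
  · rintro ⟨l, hl, rfl⟩
    exact ⟨_, ⟨l, hl, rfl⟩, rfl⟩
  · rintro ⟨_, ⟨l, hl, rfl⟩, rfl⟩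
    exact ⟨l, hl, rfl⟩

theorem ListsMinHits.lt {φ ψ : List (List ℕ)} (hφ : Valid n φ) (h : ListsMinHits φ ψ) :
    ∀ t ∈ ψ, ∀ x ∈ t, x < n := fun t ht _ hx =>
  ((h.mem t.toFinset).1 (List.mem_map.2 ⟨t, ht, rfl⟩)).lt hφ (List.mem_toFinset.2 hx)

theorem ListsMinHits.solvesDualization {φ ψ : List (List ℕ)} (hφ : Valid n φ)
    (h : ListsMinHits φ ψ) : SolvesDualization n φ ψ where
  wf :=
    { lt := h.lt hφ
      nodup_lits := fun t ht => (h.sorted t ht).imp fun h => h.ne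
      nodup := by
        have hnd := List.Nodup.map_on (f := posOf n) (l := ψ.map List.toFinset) (by
          intro u hu u' hu' heq
          rw [← positives_posOf fun x hx => ((h.mem u).1 hu).lt hφ hx, heq,
            positives_posOf fun x hx => ((h.mem u').1 hu').lt hφ hx]) h.nodup
        rw [List.map_map] at hnd
        rwa [show posLits n = posOf n ∘ List.toFinset from funext posLits_eq_posOf] }
  primeDNF t := by rw [h.mem_map_posLits hφ, mem_primeImplicants]
  dualCNF c := by rw [h.mem_map_posLits hφ, isPrimeImplicate_dual_iff]

theorem SolvesDualization.length_eq_psiCard {φ ψ : List (List ℕ)} (h : SolvesDualization n φ ψ) :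
    ψ.length = psiCard n φ := by
  classical
  have : (ψ.map (posLits n)).toFinset = primeImplicants (cnfFn n φ) := by
    ext t
    rw [List.mem_toFinset, h.primeDNF]
  rw [psiCard, ← this, List.toFinset_card_of_nodup h.wf.nodup, List.length_map]

theorem psiCard_le_psiSize {φ : List (List ℕ)} (hφ : Valid n φ) (hne : φ ≠ []) :
    psiCard n φ ≤ psiSize n φ := by
  unfold psiCard psiSize
  rw [Finset.card_eq_sum_ones]
  refine Finset.sum_le_sum fun t ht => ?_
  obtain ⟨u, hu, rfl⟩ := (isPrimeImplicant_cnfFn_iff hφ).1 (mem_primeImplicants.1 ht)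
  obtain ⟨x, hx⟩ := hu.nonempty hne
  exact Finset.card_pos.2 ⟨(⟨x, hu.lt hφ hx⟩, true), mem_posOf.2 ⟨rfl, hx⟩⟩

/-- With an empty clause in `φ` the function is 0, and the empty clause is an implicate strictly
below the clause in which variable 0 occurs, against primality of the latter. -/
theorem IsPrimeCNF.valid {φ : List (List ℕ)} (hn : 0 < n) (h : IsPrimeCNF n φ) : Valid n φ where
  nodup := h.wf.nodup_lits
  lt := h.wf.lt
  ne_nil := by
    rintro _ hnil rfl
    obtain ⟨c, hc, hx⟩ := h.occurs 0 hn
    have hempty : posLits n [] = ∅ := by simp [posLits]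
    have hfalse : ∀ v, ¬ clauseFn (∅ : Finset (Lit n)) v = true := fun v hv => by
      simpa using clauseFn_eq_true.1 hv
    refine (h.prime c hc).2.2 ∅ (by simp [Consistent]) ?_ (lt_of_le_not_ge ?_ fun hle => ?_)
    · rw [boolFn_le_iff]
      intro v hv
      simp only [cnfFn, decide_eq_true_eq] at hv
      exact hempty ▸ hv [] hnil
    · exact boolFn_le_iff.2 fun v hv => absurd hv (hfalse v)
    · refine hfalse (fun _ => true) (boolFn_le_iff.1 hle _ (clauseFn_eq_true.2 ?_))
      exact ⟨(⟨0, hn⟩, true), by simp [posLits, hx], rfl⟩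

theorem IsPrimeCNF.le_size {φ : List (List ℕ)} (h : IsPrimeCNF n φ) : n ≤ size φ := by
  have hsub : Finset.range n ⊆ φ.flatten.toFinset := by
    intro x hx
    obtain ⟨c, hc, hxc⟩ := h.occurs x (Finset.mem_range.1 hx)
    exact List.mem_toFinset.2 (List.mem_flatten.2 ⟨c, hc, hxc⟩)
  have h₁ := (Finset.card_le_card hsub).trans (List.toFinset_card_le _)
  rwa [Finset.card_range, List.length_flatten] at h₁

end Prime

/-! ### The final bounds -/

theorem Within.haltsWith {n fuel₀ K d : ℕ} {φ ψ : List (List ℕ)}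
    (h : Within (rDualize fuel₀ 1 n φ) ψ K d) : ∃ k ≤ K, HaltsWith n φ ψ ⟨k, d⟩ := by
  obtain ⟨k, hk, h⟩ := h
  refine ⟨k, hk, fuel₀, fun fuel hfuel => ?_⟩
  have := extends_rDualize hfuel 1 n φ _ _ (h ⟨0, 0⟩)
  simpa using this

theorem rDualize_correct_and_bounded {n : ℕ} {φ : List (List ℕ)} (hn : 0 < n)
    (h : IsPrimeCNF n φ) :
    ∃ (ψ : List (List ℕ)) (r : Meter), HaltsWith n φ ψ r ∧ SolvesDualization n φ ψ ∧
      1 ≤ r.depth ∧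
      r.steps ≤ 200 * (n ^ (r.depth - 1) * psiCard n φ ^ (r.depth - 1) * size φ) ∧
      ∀ k : ℕ, IsKCNF k φ → r.depth ≤ k ∧
        r.steps ≤ 200 * (n ^ (k - 1) * psiCard n φ ^ (k - 1) * size φ) := by
  have hφ := h.valid hn
  obtain ⟨c, hc, -⟩ := h.occurs 0 hn
  obtain ⟨ψ, e, hw, hψ, -, hk⟩ := within_rDualize hφ (List.ne_nil_of_mem hc) le_rfl 1
  obtain ⟨k, hkle, hhalt⟩ := hw.haltsWith
  have hsol := hψ.solvesDualization hφ
  have hlen := hsol.length_eq_psiCard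
  have hpos : 0 < psiCard n φ := by
    rw [← hlen, hψ.length]
    exact card_minHits_pos hφ
  have hsteps : k ≤ 200 * (n ^ e * psiCard n φ ^ e * size φ) := by
    refine hkle.trans ?_
    rw [hlen]
    unfold costBound
    calc 100 * (n ^ e * psiCard n φ ^ e * (n + size φ))
        ≤ 100 * (n ^ e * psiCard n φ ^ e * (size φ + size φ)) := by
          gcongr
          exact h.le_size
      _ = 200 * (n ^ e * psiCard n φ ^ e * size φ) := by ring
  refine ⟨ψ, ⟨k, 1 + e⟩, hhalt, hsol, Nat.le_add_right 1 e, ?_, fun k' hk' => ?_⟩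
  · rw [Nat.add_sub_cancel_left]
    exact hsteps
  · have hle := hk k' hk'
    refine ⟨show 1 + e ≤ k' by omega, hsteps.trans ?_⟩
    gcongr <;> omega

theorem exists_polynomial_bound (k : ℕ) :
    ∃ p : Polynomial ℕ, ∀ (n : ℕ) (φ : List (List ℕ)), 0 < n → IsPrimeCNF n φ → IsKCNF k φ → ∃ (ψ : List (List ℕ)) (r : Meter),
      HaltsWith n φ ψ r ∧ SolvesDualization n φ ψ ∧
        r.steps ≤ p.eval (size φ + psiSize n φ) := by
  -- One factor of the indeterminate for each factor of the time bound: `n`, the number of terms and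
  -- the length of `φ` are each at most the sum of the two lengths.
  refine ⟨Polynomial.C 200 * Polynomial.X ^ ((k - 1) + (k - 1) + 1), fun n φ hn h hk => ?_⟩
  obtain ⟨ψ, r, hhalt, hsol, -, -, hbound⟩ := rDualize_correct_and_bounded hn h
  refine ⟨ψ, r, hhalt, hsol, (hbound k hk).2.trans ?_⟩
  obtain ⟨c, hc, -⟩ := h.occurs 0 hn
  have h₁ := psiCard_le_psiSize (h.valid hn) (List.ne_nil_of_mem hc)
  have h₂ := h.le_size
  rw [Polynomial.eval_mul, Polynomial.eval_C, Polynomial.eval_pow, Polynomial.eval_X, pow_succ,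
    pow_add]
  gcongr <;> omega

end RDualization

theorem mainTheorem12 :
    (∃ C : ℕ, ∀ (n : ℕ) (φ : List (List ℕ)), 0 < n → RDualization.IsPrimeCNF n φ →
      ∃ (ψ : List (List ℕ)) (r : RDualization.Meter),
        RDualization.HaltsWith n φ ψ r ∧
        RDualization.SolvesDualization n φ ψ ∧
        1 ≤ r.depth ∧
        r.steps ≤ C * (n ^ (r.depth - 1) * RDualization.psiCard n φ ^ (r.depth - 1) *
          RDualization.size φ) ∧
        ∀ k : ℕ, RDualization.IsKCNF k φ →
          r.depth ≤ k ∧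
          r.steps ≤ C * (n ^ (k - 1) * RDualization.psiCard n φ ^ (k - 1) *
            RDualization.size φ)) ∧
    (∀ k : ℕ, ∃ p : Polynomial ℕ, ∀ (n : ℕ) (φ : List (List ℕ)), 0 < n →
      RDualization.IsPrimeCNF n φ → RDualization.IsKCNF k φ →
      ∃ (ψ : List (List ℕ)) (r : RDualization.Meter),
        RDualization.HaltsWith n φ ψ r ∧
        RDualization.SolvesDualization n φ ψ ∧
        r.steps ≤ p.eval (RDualization.size φ + RDualization.psiSize n φ)) :=
  ⟨⟨200, fun _ _ hn h => RDualization.rDualize_correct_and_bounded hn h⟩,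
    RDualization.exists_polynomial_bound⟩
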